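/- Let $p$ be a prime number, $F$ a non-archimedean local field with residue field of characteristic $p$, ring of integers $\mathcal O$, maximal ideal $\mathfrak p$ and a fixed uniformizer $\varpi$, and let $k$ be an algebraically closed field of characteristic $p$. Put $G=\mathrm{GL}_2(F)$, $K=\mathrm{GL}_2(\mathcal O)$, let $Z$ be the centre of $G$, $I\subset K$ the subgroup of matrices that are upper triangular modulo $\mathfrak p$, $N$ the normalizer of $I$ in $G$, $P^+=\begin{pmatrix}\mathcal O\setminus\{0\}&\mathcal O\\0&1\end{pmatrix}$ and $\Pi=\begin{pmatrix}0&1\\ \varpi&0\end{pmatrix}$. All representations are on $k$-vector spaces; a representation is smooth if every vector is fixed by an open subgroup. A diagram is a triple $(D_0,D_1,r)$ with $D_0$ a smooth representation of $KZ$, $D_1$ a smooth representation of $N$ and $r:D_1\to D_0$ a linear $IZ$-equivariant map; a morphism $(D_0,D_1,r)\to(D_0',D_1',r')$ is a pair $(\varphi_0,\varphi_1)$ of a $KZ$-equivariant linear map $\varphi_0:D_0\to D_0'$ and an $N$-equivariant linear map $\varphi_1:D_1\to D_1'$ with $\varphi_0\circ r=r'\circ\varphi_1$. Diagrams form a category $\mathrm{DIAG}$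 whose Hom sets are $k$-vector spaces. For a smooth representation $\pi'$ of $G$ put $\mathcal K(\pi')=(\pi'|_{KZ},\pi'|_N,\mathrm{id})$. Let $\pi$ be an irreducible smooth representation of $G$ with a central character. Then $\pi|_{KZ}$ has an irreducible subrepresentation. Let $\sigma\subset\pi|_{KZ}$ be any one, and put $$I^+(\pi)=\langle P^+\cdot\sigma\rangle,\quad I^-(\pi)=\Pi\cdot I^+(\pi),\quad D_1(\pi)=I^+(\pi)\cap I^-(\pi),\quad D_0(\pi)=\langle K\cdot D_1(\pi)\rangle\subset\pi,$$ where $\langle\cdot\rangle$ is the $k$-linear span; let $D(\pi)=(D_0(\pi),D_1(\pi),\mathrm{can})$, with $\mathrm{can}$ the inclusion, be the canonical diagram of $\pi$. Then, for every smooth representation $\pi'$ of $G$ (not necessarily irreducible), there is an isomorphism of $k$-vector spaces, natural in $\pi'$, $$\mathrm{Hom}_{\mathrm{DIAG}}(D(\pi),\mathcal K(\pi'))\;\cong\;\mathrm{Hom}_G(\pi,\pi'),$$ whose inverse sends $\varphi:\pi\to\pi'$ to the composite of the inclusion $D(\pi)\hookrightarrow\mathcal K(\pi)$ with $\mathcal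 K(\varphi):\mathcal K(\pi)\to\mathcal K(\pi')$. -/

import Mathlib

open scoped ValuativeRel

noncomputable section

open ValuativeRel Matrix

namespace CanonicalDiagram

set_option linter.unusedSectionVars false

section Groups

variable (F : Type*) [Field F] [ValuativeRel F] 

/-- `K = GL₂(𝒪)`, as a subgroup of `G = GL₂(F)`. -/
def maxCompact : Subgroup (GL (Fin 2) F) :=
  (Matrix.GeneralLinearGroup.map (n := Fin 2) (algebraMap 𝒪[F] F)).range

variable {F}

theorem mem_maxCompact {g : GL (Fin 2) F} :
    g ∈ maxCompact F ↔ (∀ i j, valuation F (g.1 i j) ≤ 1) ∧ valuation F g.1.det = 1 := by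
  constructor
  · rintro ⟨h, rfl⟩
    refine ⟨fun i j => (h.1 i j).2, ?_⟩
    have h1 : ((GeneralLinearGroup.map (algebraMap 𝒪[F] F) h).1).det
        = algebraMap 𝒪[F] F h.1.det := by
      rw [RingHom.map_det]; rfl
    rw [h1]
    exact (Valuation.integer.integers (valuation F)).one_of_isUnit
      ((Matrix.isUnit_iff_isUnit_det _).1 h.isUnit)
  · rintro ⟨h1, h2⟩
    let A : Matrix (Fin 2) (Fin 2) 𝒪[F] := Matrix.of fun i j => ⟨g.1 i j, h1 i j⟩
    have hA : algebraMap 𝒪[F] F A.det = g.1.det := by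
      rw [RingHom.map_det]; rfl
    have hu : IsUnit A.det :=
      (Valuation.integer.integers (valuation F)).isUnit_of_one' (by rw [hA]; exact h2)
    refine ⟨GeneralLinearGroup.mk'' A hu, ?_⟩
    apply GeneralLinearGroup.ext
    intro i j
    rfl

theorem inv_apply_one_zero (g : GL (Fin 2) F) :
    (g⁻¹).1 1 0 = -(g.1.det)⁻¹ * g.1 1 0 := by
  have h : (g⁻¹).1 = (g.1)⁻¹ := GeneralLinearGroup.coe_inv g
  rw [h, Matrix.inv_def, Matrix.adjugate_fin_two]
  simp

variable (F) in
/-- The Iwahori subgroup `I ⊆ K` of the matrices that are upper triangular modulo `𝔭`. -/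
def iwahori : Subgroup (GL (Fin 2) F) where
  carrier := {g | g ∈ maxCompact F ∧ valuation F (g.1 1 0) < 1}
  one_mem' := ⟨one_mem _, by simp⟩
  mul_mem' := by
    rintro a b ⟨ha, ha'⟩ ⟨hb, hb'⟩
    refine ⟨mul_mem ha hb, ?_⟩
    rw [GeneralLinearGroup.coe_mul, Matrix.mul_apply, Fin.sum_univ_two]
    apply Valuation.map_add_lt
    · rw [map_mul]
      exact (mul_le_of_le_one_right' ((mem_maxCompact.1 hb).1 0 0)).trans_lt ha'
    · rw [map_mul]
      exact (mul_le_of_le_one_left' ((mem_maxCompact.1 ha).1 1 1)).trans_lt hb'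
  inv_mem' := by
    rintro a ⟨ha, ha'⟩
    refine ⟨inv_mem ha, ?_⟩
    rw [inv_apply_one_zero, map_mul, Valuation.map_neg, map_inv₀, (mem_maxCompact.1 ha).2]
    simpa using ha'

variable (F) in
/-- `KZ`, with `Z` the centre of `G`. -/
def KZ : Subgroup (GL (Fin 2) F) := maxCompact F ⊔ Subgroup.center (GL (Fin 2) F)

variable (F) in
/-- `IZ`. -/
def IZ : Subgroup (GL (Fin 2) F) := iwahori F ⊔ Subgroup.center (GL (Fin 2) F)

variable (F) in
/-- `N`, the normalizer of `I` in `G`. -/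
def N : Subgroup (GL (Fin 2) F) := Subgroup.normalizer (iwahori F : Set (GL (Fin 2) F))

theorem iwahori_le_maxCompact : iwahori F ≤ maxCompact F := fun _ h => h.1

theorem IZ_le_KZ : IZ F ≤ KZ F := sup_le_sup_right iwahori_le_maxCompact _

theorem center_le_N : Subgroup.center (GL (Fin 2) F) ≤ N F :=
  Subgroup.center_le_normalizer _

theorem IZ_le_N : IZ F ≤ N F := sup_le Subgroup.le_normalizer center_le_N

variable (F) in
/-- The monoid `P⁺` of the matrices `(a b; 0 1)` with `a ∈ 𝒪 - {0}` and `b ∈ 𝒪`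
(`a ≠ 0` because the matrix is invertible). -/
def Pplus : Submonoid (GL (Fin 2) F) where
  carrier := {g | g.1 0 0 ∈ 𝒪[F] ∧ g.1 0 1 ∈ 𝒪[F] ∧ g.1 1 0 = 0 ∧ g.1 1 1 = 1}
  one_mem' := by simp [one_mem, zero_mem]
  mul_mem' := by
    rintro a b ⟨ha, ha1, ha2, ha3⟩ ⟨hb, hb1, hb2, hb3⟩
    simp only [Set.mem_ofPred_eq, GeneralLinearGroup.coe_mul, Matrix.mul_apply, Fin.sum_univ_two,
      ha2, ha3, hb2, hb3, mul_zero, add_zero, zero_mul, zero_add, mul_one, and_self, and_true]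
    exact ⟨mul_mem ha hb, add_mem (mul_mem ha hb1) ha1⟩

/-- The matrix `Π = (0 1; ϖ 0)` of `G`. -/
def PiMat (ϖ : 𝒪[F]) (hϖ : Irreducible ϖ) : GL (Fin 2) F :=
  GeneralLinearGroup.mkOfDetNeZero !![0, 1; (ϖ : F), 0] (by
    have := hϖ.ne_zero
    simpa [Matrix.det_fin_two] using this)

end Groups

section NormalizerOfIwahori

variable {F : Type*} [Field F] [ValuativeRel F] [TopologicalSpace F] [IsNonarchimedeanLocalField F]

theorem exists_valuation_eq_zpow {ϖ : 𝒪[F]} (hϖ : Irreducible ϖ) {x : F} (hx : x ≠ 0) :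
    ∃ n : ℤ, valuation F x = valuation F (ϖ : F) ^ n := by
  obtain ⟨n, u, hu⟩ :=
    IsDiscreteValuationRing.exists_units_eq_smul_zpow_of_irreducible hϖ hx
  refine ⟨n, ?_⟩
  rw [hu, Units.smul_def, Algebra.smul_def, map_mul, map_zpow₀,
    (Valuation.integer.integers (valuation F)).valuation_unit u, one_mul]
  rfl


theorem valuation_le_zpow {ϖ : 𝒪[F]} (hϖ : Irreducible ϖ) {x : F} {s t m : ℤ}
    (h : valuation F x ^ 2 * valuation F (ϖ : F) ^ s < valuation F (ϖ : F) ^ t)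
    (hm : 2 * m ≤ t - s + 2) : valuation F x ≤ valuation F (ϖ : F) ^ m := by
  have h0 : 0 < valuation F (ϖ : F) := Valuation.integer.v_irreducible_pos hϖ
  have h1 : valuation F (ϖ : F) < 1 := Valuation.integer.v_irreducible_lt_one hϖ
  by_cases hx : x = 0
  · simp [hx]
  obtain ⟨j, hj⟩ := exists_valuation_eq_zpow hϖ hx
  rw [hj, ← zpow_natCast, ← _root_.zpow_mul, ← zpow_add₀ h0.ne',
    zpow_lt_zpow_iff_right_of_lt_one₀ h0 h1] at h
  rw [hj, zpow_le_zpow_iff_right_of_lt_one₀ h0 h1]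
  push_cast at h
  omega

theorem scalar_mem_center (u : Fˣ) :
    GeneralLinearGroup.scalar (Fin 2) u ∈ Subgroup.center (GL (Fin 2) F) :=
  Subgroup.mem_center_iff.2 fun g => (GeneralLinearGroup.scalar_commute u g).symm

theorem mul_mul_inv_entries (g h : GL (Fin 2) F) :
    (g * h * g⁻¹).1 0 1 = g.1.det⁻¹ * (-(g.1 0 0 * h.1 0 0 + g.1 0 1 * h.1 1 0) * g.1 0 1
        + (g.1 0 0 * h.1 0 1 + g.1 0 1 * h.1 1 1) * g.1 0 0) ∧
    (g * h * g⁻¹).1 1 0 = g.1.det⁻¹ * ((g.1 1 0 * h.1 0 0 + g.1 1 1 * h.1 1 0) * g.1 1 1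
        - (g.1 1 0 * h.1 0 1 + g.1 1 1 * h.1 1 1) * g.1 1 0) := by
  have h' : (g⁻¹).1 = (g.1)⁻¹ := GeneralLinearGroup.coe_inv g
  constructor <;>
  · rw [GeneralLinearGroup.coe_mul, GeneralLinearGroup.coe_mul, h', Matrix.inv_def,
      Matrix.adjugate_fin_two]
    simp [Matrix.mul_apply, Fin.sum_univ_two]
    ring

/-- `N` is generated by `I`, `Π` and `Z`. -/
theorem exists_of_mem_N {ϖ : 𝒪[F]} (hϖ : Irreducible ϖ) {g : GL (Fin 2) F} (hg : g ∈ N F) :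
    ∃ z ∈ Subgroup.center (GL (Fin 2) F), ∃ h ∈ iwahori F,
      g = z * h ∨ g = z * (PiMat ϖ hϖ * h) := by
  have h0 : 0 < valuation F (ϖ : F) := Valuation.integer.v_irreducible_pos hϖ
  have h1 : valuation F (ϖ : F) < 1 := Valuation.integer.v_irreducible_lt_one hϖ
  have hϖ0 : (ϖ : F) ≠ 0 := by simpa using hϖ.ne_zero
  have hΔ : g.1.det ≠ 0 := GeneralLinearGroup.det_ne_zero g
  have hvΔ : 0 < valuation F g.1.det := by simpa [zero_lt_iff] using hΔ
  obtain ⟨n, hn⟩ := exists_valuation_eq_zpow hϖ hΔ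
  have hlt : valuation F (ϖ : F) ^ n < valuation F (ϖ : F) ^ (n - 1) := by
    rw [zpow_lt_zpow_iff_right_of_lt_one₀ h0 h1]; omega
  let u : GL (Fin 2) F := GeneralLinearGroup.mkOfDetNeZero !![1, 1; 0, 1]
    (by simp [Matrix.det_fin_two])
  let w : GL (Fin 2) F := GeneralLinearGroup.mkOfDetNeZero !![1, 0; (ϖ : F), 1]
    (by simp [Matrix.det_fin_two])
  have huval : u.1 = !![1, 1; 0, 1] := rfl
  have hwval : w.1 = !![1, 0; (ϖ : F), 1] := rfl
  have hu : u ∈ iwahori F := by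
    refine ⟨mem_maxCompact.2 ⟨?_, ?_⟩, ?_⟩ <;> simp [huval, Matrix.det_fin_two, Fin.forall_fin_two]
  have hw : w ∈ iwahori F := by
    refine ⟨mem_maxCompact.2 ⟨?_, ?_⟩, ?_⟩ <;>
      simp [hwval, Matrix.det_fin_two, Fin.forall_fin_two, h1, h1.le]
  have hgu : g * u * g⁻¹ ∈ iwahori F := (hg u).1 hu
  have hgw : g * w * g⁻¹ ∈ iwahori F := (hg w).1 hw
  have hu1 := (mem_maxCompact.1 hgu.1).1 0 1
  have hu2 := hgu.2
  have hw1 := (mem_maxCompact.1 hgw.1).1 0 1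
  have hw2 := hgw.2
  rw [(mul_mul_inv_entries g u).1] at hu1
  rw [(mul_mul_inv_entries g u).2] at hu2
  rw [(mul_mul_inv_entries g w).1] at hw1
  rw [(mul_mul_inv_entries g w).2] at hw2
  have eu1 : g.1.det⁻¹ * (-(g.1 0 0 * u.1 0 0 + g.1 0 1 * u.1 1 0) * g.1 0 1
        + (g.1 0 0 * u.1 0 1 + g.1 0 1 * u.1 1 1) * g.1 0 0) = g.1.det⁻¹ * g.1 0 0 ^ 2 := by
    simp only [huval, Matrix.of_apply, Matrix.cons_val]; ring
  have eu2 : g.1.det⁻¹ * ((g.1 1 0 * u.1 0 0 + g.1 1 1 * u.1 1 0) * g.1 1 1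
        - (g.1 1 0 * u.1 0 1 + g.1 1 1 * u.1 1 1) * g.1 1 0)
        = -(g.1.det⁻¹ * g.1 1 0 ^ 2) := by
    simp [huval]; ring
  have ew1 : g.1.det⁻¹ * (-(g.1 0 0 * w.1 0 0 + g.1 0 1 * w.1 1 0) * g.1 0 1
        + (g.1 0 0 * w.1 0 1 + g.1 0 1 * w.1 1 1) * g.1 0 0)
        = -(g.1.det⁻¹ * (g.1 0 1 ^ 2 * ϖ)) := by
    simp [hwval]; ring
  have ew2 : g.1.det⁻¹ * ((g.1 1 0 * w.1 0 0 + g.1 1 1 * w.1 1 0) * g.1 1 1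
        - (g.1 1 0 * w.1 0 1 + g.1 1 1 * w.1 1 1) * g.1 1 0)
        = g.1.det⁻¹ * (g.1 1 1 ^ 2 * ϖ) := by
    simp only [hwval, Matrix.of_apply, Matrix.cons_val]; ring
  rw [eu1, map_mul, map_inv₀, inv_mul_le_iff₀ hvΔ, mul_one, hn, map_pow] at hu1
  rw [eu2, Valuation.map_neg, map_mul, map_inv₀, inv_mul_lt_iff₀ hvΔ, mul_one, hn, map_pow] at hu2
  rw [ew1, Valuation.map_neg, map_mul, map_inv₀, inv_mul_le_iff₀ hvΔ, mul_one, hn, map_mul,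
    map_pow] at hw1
  rw [ew2, map_mul, map_inv₀, inv_mul_lt_iff₀ hvΔ, mul_one, hn, map_mul, map_pow] at hw2
  have ha (m : ℤ) (hm : 2 * m ≤ n + 1) : valuation F (g.1 0 0) ≤ valuation F (ϖ : F) ^ m :=
    valuation_le_zpow hϖ (s := 0) (t := n - 1) (by simpa using hu1.trans_lt hlt) (by omega)
  have hc (m : ℤ) (hm : 2 * m ≤ n + 2) : valuation F (g.1 1 0) ≤ valuation F (ϖ : F) ^ m :=
    valuation_le_zpow hϖ (s := 0) (t := n) (by simpa using hu2) (by omega)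
  have hb (m : ℤ) (hm : 2 * m ≤ n) : valuation F (g.1 0 1) ≤ valuation F (ϖ : F) ^ m :=
    valuation_le_zpow hϖ (s := 1) (t := n - 1) (by simpa using hw1.trans_lt hlt) (by omega)
  have hd (m : ℤ) (hm : 2 * m ≤ n + 1) : valuation F (g.1 1 1) ≤ valuation F (ϖ : F) ^ m :=
    valuation_le_zpow hϖ (s := 1) (t := n) (by simpa using hw2) (by omega)
  have key (x : F) (m r : ℤ) (hx : valuation F x ≤ valuation F (ϖ : F) ^ m) (hr : r ≤ m) :
      valuation F (((ϖ : F) ^ r)⁻¹ * x) ≤ 1 := by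
    rw [map_mul, map_inv₀, map_zpow₀, inv_mul_le_iff₀ (zpow_pos h0 r), mul_one]
    exact hx.trans ((zpow_le_zpow_iff_right_of_lt_one₀ h0 h1).2 hr)
  have key' (x : F) (m r : ℤ) (hx : valuation F x ≤ valuation F (ϖ : F) ^ m) (hr : r < m) :
      valuation F (((ϖ : F) ^ r)⁻¹ * x) < 1 := by
    rw [map_mul, map_inv₀, map_zpow₀, inv_mul_lt_iff₀ (zpow_pos h0 r), mul_one]
    exact hx.trans_lt ((zpow_lt_zpow_iff_right_of_lt_one₀ h0 h1).2 hr)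
  have hdet : g.1.det = g.1 0 0 * g.1 1 1 - g.1 0 1 * g.1 1 0 := Matrix.det_fin_two _
  obtain ⟨r, hr⟩ := Int.even_or_odd' n
  have hϖr : (ϖ : F) ^ r ≠ 0 := zpow_ne_zero _ hϖ0
  refine ⟨GeneralLinearGroup.scalar (Fin 2) (Units.mk0 _ hϖr), scalar_mem_center _, ?_⟩
  rcases hr with hr | hr
  · let A : Matrix (Fin 2) (Fin 2) F := !![((ϖ : F) ^ r)⁻¹ * g.1 0 0, ((ϖ : F) ^ r)⁻¹ * g.1 0 1;
      ((ϖ : F) ^ r)⁻¹ * g.1 1 0, ((ϖ : F) ^ r)⁻¹ * g.1 1 1]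
    have hA : A.det = ((ϖ : F) ^ r * (ϖ : F) ^ r)⁻¹ * g.1.det := by
      rw [hdet]; simp only [A, Matrix.det_fin_two_of, mul_inv]; ring
    refine ⟨GeneralLinearGroup.mkOfDetNeZero A (by rw [hA]; positivity), ?_, Or.inl ?_⟩
    · refine ⟨mem_maxCompact.2 ⟨?_, ?_⟩, ?_⟩
      · simp only [Fin.forall_fin_two]
        exact ⟨⟨key _ r r (ha r (by omega)) le_rfl, key _ r r (hb r (by omega)) le_rfl⟩,
          ⟨key _ r r (hc r (by omega)) le_rfl, key _ r r (hd r (by omega)) le_rfl⟩⟩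
      · change valuation F A.det = 1
        rw [hA, map_mul, hn, map_inv₀, map_mul, map_zpow₀, ← zpow_add₀ h0.ne', hr, two_mul,
          inv_mul_cancel₀ (zpow_ne_zero _ h0.ne')]
      · exact key' _ (r + 1) r (hc (r + 1) (by omega)) (by omega)
    · apply GeneralLinearGroup.ext
      intro i j
      fin_cases i <;> fin_cases j <;>
        simp [A, hϖr]
  · let A : Matrix (Fin 2) (Fin 2) F :=
      !![((ϖ : F) ^ (r + 1))⁻¹ * g.1 1 0, ((ϖ : F) ^ (r + 1))⁻¹ * g.1 1 1;
        ((ϖ : F) ^ r)⁻¹ * g.1 0 0, ((ϖ : F) ^ r)⁻¹ * g.1 0 1]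
    have hA : A.det = -(((ϖ : F) ^ (r + 1) * (ϖ : F) ^ r)⁻¹ * g.1.det) := by
      rw [hdet]; simp only [A, Matrix.det_fin_two_of, mul_inv]; ring
    refine ⟨GeneralLinearGroup.mkOfDetNeZero A (by
      rw [hA, neg_ne_zero]
      exact mul_ne_zero (inv_ne_zero (mul_ne_zero (zpow_ne_zero _ hϖ0) hϖr)) hΔ), ?_, Or.inr ?_⟩
    · refine ⟨mem_maxCompact.2 ⟨?_, ?_⟩, ?_⟩
      · simp only [Fin.forall_fin_two]
        exact ⟨⟨key _ (r + 1) (r + 1) (hc _ (by omega)) le_rfl,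
            key _ (r + 1) (r + 1) (hd _ (by omega)) le_rfl⟩,
          ⟨key _ r r (ha r (by omega)) le_rfl, key _ r r (hb r (by omega)) le_rfl⟩⟩
      · change valuation F A.det = 1
        rw [hA, Valuation.map_neg, map_mul, hn, map_inv₀, map_mul, map_zpow₀, map_zpow₀,
          ← zpow_add₀ h0.ne', hr, show r + 1 + r = 2 * r + 1 by ring,
          inv_mul_cancel₀ (zpow_ne_zero _ h0.ne')]
      · exact key' _ (r + 1) r (ha (r + 1) (by omega)) (by omega)
    · have e : (ϖ : F) ^ (r + 1) = ϖ ^ r * ϖ := zpow_add_one₀ hϖ0 r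
      apply GeneralLinearGroup.ext
      intro i j
      fin_cases i <;> fin_cases j <;>
        simp [A, PiMat, Matrix.mul_apply, Fin.sum_univ_two, e] <;>
        field_simp

/-- `I P⁺ ⊆ P⁺ K`. -/
theorem iwahori_mul_Pplus {h x : GL (Fin 2) F} (hh : h ∈ iwahori F) (hx : x ∈ Pplus F) :
    ∃ y ∈ Pplus F, ∃ k ∈ maxCompact F, h * x = y * k := by
  obtain ⟨hK, hc⟩ := hh
  obtain ⟨hK, hdet⟩ := mem_maxCompact.1 hK
  obtain ⟨hx0, hx1, hx2, hx3⟩ := hx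
  have hD : h.1.det = h.1 0 0 * h.1 1 1 - h.1 0 1 * h.1 1 0 := Matrix.det_fin_two _
  have hxD : x.1.det = x.1 0 0 := by rw [Matrix.det_fin_two, hx2, hx3]; ring
  have hx00 : x.1 0 0 ≠ 0 := hxD ▸ GeneralLinearGroup.det_ne_zero x
  have hD0 : h.1.det ≠ 0 := GeneralLinearGroup.det_ne_zero h
  set e : F := h.1 1 0 * x.1 0 1 + h.1 1 1 with he
  have hcy : valuation F (h.1 1 0 * x.1 0 1) < 1 := by
    rw [map_mul]; exact (mul_le_of_le_one_right' hx1).trans_lt hc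
  have hd : valuation F (h.1 1 1) = 1 := by
    refine le_antisymm (hK 1 1) (not_lt.1 fun hlt => ?_)
    refine hdet.not_lt ?_
    rw [hD]
    apply Valuation.map_sub_lt
    · rw [map_mul]; exact (mul_le_of_le_one_left' (hK 0 0)).trans_lt hlt
    · rw [map_mul]; exact (mul_le_of_le_one_left' (hK 0 1)).trans_lt hc
  have hve : valuation F e = 1 := by
    rw [he, Valuation.map_add_eq_of_lt_right _ (by rw [hd]; exact hcy), hd]
  have he0 : e ≠ 0 := by
    rintro h0; rw [h0, map_zero] at hve; exact zero_ne_one hve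
  let y : GL (Fin 2) F := GeneralLinearGroup.mkOfDetNeZero
    !![x.1 0 0 * h.1.det / e ^ 2, (h.1 0 0 * x.1 0 1 + h.1 0 1) / e; 0, 1] (by
      rw [Matrix.det_fin_two_of, mul_one, mul_zero, sub_zero]
      exact div_ne_zero (mul_ne_zero hx00 hD0) (pow_ne_zero _ he0))
  let k : GL (Fin 2) F := GeneralLinearGroup.mkOfDetNeZero
    !![e, 0; h.1 1 0 * x.1 0 0, e] (by simp [Matrix.det_fin_two, he0])
  have hy : y.1 = !![x.1 0 0 * h.1.det / e ^ 2, (h.1 0 0 * x.1 0 1 + h.1 0 1) / e; 0, 1] := rfl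
  have hk : k.1 = !![e, 0; h.1 1 0 * x.1 0 0, e] := rfl
  refine ⟨y, ⟨?_, ?_, ?_, ?_⟩, k, mem_maxCompact.2 ⟨?_, ?_⟩, ?_⟩
  · rw [hy]
    change valuation F (x.1 0 0 * h.1.det / e ^ 2) ≤ 1
    rw [map_div₀, map_mul, map_pow, hve, hdet]
    simpa using (show valuation F (x.1 0 0) ≤ 1 from hx0)
  · rw [hy]
    change valuation F ((h.1 0 0 * x.1 0 1 + h.1 0 1) / e) ≤ 1
    rw [map_div₀, hve, div_one]
    refine Valuation.map_add_le _ ?_ (hK 0 1)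
    rw [map_mul]
    exact mul_le_one' (hK 0 0) hx1
  · rw [hy]; rfl
  · rw [hy]; rfl
  · rw [hk]
    simp only [Fin.forall_fin_two]
    refine ⟨⟨hve.le, ?_⟩, ?_, hve.le⟩
    · change valuation F 0 ≤ 1
      simp
    · change valuation F (h.1 1 0 * x.1 0 0) ≤ 1
      rw [map_mul]
      exact mul_le_one' (hK 1 0) hx0
  · rw [hk, Matrix.det_fin_two_of, zero_mul, sub_zero, map_mul, hve, one_mul]
  · apply GeneralLinearGroup.ext
    intro i j
    rw [GeneralLinearGroup.coe_mul, GeneralLinearGroup.coe_mul, Matrix.mul_apply,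
      Matrix.mul_apply, Fin.sum_univ_two, Fin.sum_univ_two, hy, hk]
    fin_cases i <;> fin_cases j <;>
      simp only [Fin.zero_eta, Fin.mk_one, Matrix.of_apply, Matrix.cons_val, hx2, hx3]
    · rw [hD]
      field_simp
      rw [he]
      ring
    · field_simp
      ring
    · ring
    · rw [he]
      ring

theorem PiMat_mul_self_mem_center {ϖ : 𝒪[F]} (hϖ : Irreducible ϖ) :
    PiMat ϖ hϖ * PiMat ϖ hϖ ∈ Subgroup.center (GL (Fin 2) F) := by
  have hϖ0 : (ϖ : F) ≠ 0 := by simpa using hϖ.ne_zero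
  have : PiMat ϖ hϖ * PiMat ϖ hϖ = GeneralLinearGroup.scalar (Fin 2) (Units.mk0 _ hϖ0) := by
    apply GeneralLinearGroup.ext
    intro i j
    fin_cases i <;> fin_cases j <;>
      simp [PiMat, Matrix.mul_apply, Fin.sum_univ_two]
  rw [this]
  exact scalar_mem_center _

/-- `Π` normalizes `I`. -/
theorem PiMat_mem_N {ϖ : 𝒪[F]} (hϖ : Irreducible ϖ) : PiMat ϖ hϖ ∈ N F := by
  have h0 : 0 < valuation F (ϖ : F) := Valuation.integer.v_irreducible_pos hϖ
  have h1 : valuation F (ϖ : F) < 1 := Valuation.integer.v_irreducible_lt_one hϖ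
  have hϖ0 : (ϖ : F) ≠ 0 := by simpa using hϖ.ne_zero
  have key : ∀ h ∈ iwahori F, PiMat ϖ hϖ * h * (PiMat ϖ hϖ)⁻¹ ∈ iwahori F := by
    rintro h ⟨hK, hc⟩
    obtain ⟨hK, hdet⟩ := mem_maxCompact.1 hK
    have hD : h.1.det = h.1 0 0 * h.1 1 1 - h.1 0 1 * h.1 1 0 := Matrix.det_fin_two _
    let A : Matrix (Fin 2) (Fin 2) F :=
      !![h.1 1 1, (ϖ : F)⁻¹ * h.1 1 0; (ϖ : F) * h.1 0 1, h.1 0 0]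
    have hA : A.det = h.1.det := by
      rw [hD, Matrix.det_fin_two_of]; field_simp
    have e : PiMat ϖ hϖ * h * (PiMat ϖ hϖ)⁻¹ = GeneralLinearGroup.mkOfDetNeZero A
        (hA ▸ GeneralLinearGroup.det_ne_zero h) := by
      rw [mul_inv_eq_iff_eq_mul]
      apply GeneralLinearGroup.ext
      intro i j
      fin_cases i <;> fin_cases j <;>
        simp [A, PiMat, Matrix.mul_apply, Fin.sum_univ_two, hϖ0, mul_comm]
    rw [e]
    refine ⟨mem_maxCompact.2 ⟨?_, ?_⟩, ?_⟩
    · simp only [Fin.forall_fin_two]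
      refine ⟨⟨hK 1 1, ?_⟩, ?_, hK 0 0⟩
      · change valuation F ((ϖ : F)⁻¹ * h.1 1 0) ≤ 1
        rw [map_mul, map_inv₀, inv_mul_le_iff₀ h0, mul_one]
        simpa using valuation_le_zpow hϖ (s := 0) (t := 0) (m := 1)
          (by simpa using pow_lt_one₀ zero_le hc two_ne_zero) (by norm_num)
      · change valuation F ((ϖ : F) * h.1 0 1) ≤ 1
        rw [map_mul]
        exact mul_le_one' h1.le (hK 0 1)
    · exact (congrArg _ hA).trans hdet
    · change valuation F ((ϖ : F) * h.1 0 1) < 1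
      rw [map_mul]
      exact (mul_le_of_le_one_right' (hK 0 1)).trans_lt h1
  intro h
  refine ⟨key h, fun hh => ?_⟩
  have h2 := key _ hh
  have hz := Subgroup.mem_center_iff.1 (PiMat_mul_self_mem_center hϖ) h
  have e : PiMat ϖ hϖ * (PiMat ϖ hϖ * h * (PiMat ϖ hϖ)⁻¹) * (PiMat ϖ hϖ)⁻¹ = h := by
    rw [mul_inv_eq_iff_eq_mul, ← mul_assoc, mul_inv_eq_iff_eq_mul, ← mul_assoc, ← hz, mul_assoc]
  rwa [e] at h2

end NormalizerOfIwahori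
section Representations

variable {k H V : Type*} [Field k] [Group H] [AddCommGroup V] [Module k V]

/-- A representation of a topological group is smooth if every vector is fixed by an open
subgroup. -/
def IsSmooth [TopologicalSpace H] (ρ : Representation k H V) : Prop :=
  ∀ v : V, ∃ U : Subgroup H, IsOpen (U : Set H) ∧ ∀ g ∈ U, ρ g v = v

/-- The centre of the group acts through a character. -/
def HasCentralCharacter (ρ : Representation k H V) : Prop :=
  ∃ χ : Subgroup.center H →* kˣ, ∀ (z : Subgroup.center H) (v : V), ρ z v = (χ z : k) • v

/-- The restriction of a representation to a subgroup. -/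
def res (ρ : Representation k H V) (S : Subgroup H) : Representation k S V :=
  ρ.comp S.subtype

theorem IsSmooth.res [TopologicalSpace H] {ρ : Representation k H V} (hρ : IsSmooth ρ)
    (S : Subgroup H) : IsSmooth (res ρ S) := fun v => by
  obtain ⟨U, hU, h⟩ := hρ v
  exact ⟨U.comap S.subtype, hU.preimage continuous_subtype_val, fun g hg => h g hg⟩

theorem IsSmooth.toRepresentation [TopologicalSpace H] {ρ : Representation k H V}
    (hρ : IsSmooth ρ) (W : Subrepresentation ρ) : IsSmooth W.toRepresentation := fun v => by
  obtain ⟨U, hU, h⟩ := hρ v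
  exact ⟨U, hU, fun g hg => Subtype.ext (h g hg)⟩

end Representations

section Diagrams

universe u v w

/-- A diagram `(D₀, D₁, r)`: a smooth representation `D₀` of `KZ`, a smooth representation `D₁`
of `N` and an `IZ`-equivariant linear map `r : D₁ → D₀`. -/
structure Diagram (F : Type u) [Field F] [ValuativeRel F] [TopologicalSpace F]
    (k : Type v) [Field k] where
  V₀ : Type w
  V₁ : Type w
  [addCommGroup₀ : AddCommGroup V₀]
  [module₀ : Module k V₀]
  [addCommGroup₁ : AddCommGroup V₁]
  [module₁ : Module k V₁]
  D₀ : Representation k (KZ F) V₀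
  D₁ : Representation k (N F) V₁
  smooth₀ : IsSmooth D₀
  smooth₁ : IsSmooth D₁
  r : V₁ →ₗ[k] V₀
  equivariant : ∀ (g : GL (Fin 2) F) (hg : g ∈ IZ F) (x : V₁),
    r (D₁ ⟨g, IZ_le_N hg⟩ x) = D₀ ⟨g, IZ_le_KZ hg⟩ (r x)

attribute [instance] Diagram.addCommGroup₀ Diagram.module₀ Diagram.addCommGroup₁ Diagram.module₁

/-- A smooth representation of `G = GL₂(F)`. -/
structure SmoothRep (F : Type u) [Field F] [TopologicalSpace F] (k : Type v) [Field k] where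
  V : Type w
  [addCommGroup : AddCommGroup V]
  [module : Module k V]
  ρ : Representation k (GL (Fin 2) F) V
  smooth : IsSmooth ρ

attribute [instance] SmoothRep.addCommGroup SmoothRep.module

variable {F : Type u} [Field F] [ValuativeRel F] [TopologicalSpace F] {k : Type v} [Field k]

namespace Diagram

universe w₁ w₂ w₃

/-- The `k`-vector space of morphisms of diagrams: pairs of a `KZ`-equivariant map `φ₀` and an
`N`-equivariant map `φ₁` such that `φ₀ ∘ r = r' ∘ φ₁`. -/
def Hom (D : Diagram.{u, v, w₁} F k) (D' : Diagram.{u, v, w₂} F k) :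
    Submodule k (D.D₀.IntertwiningMap D'.D₀ × D.D₁.IntertwiningMap D'.D₁) where
  carrier := {φ | ∀ x : D.V₁, φ.1 (D.r x) = D'.r (φ.2 x)}
  add_mem' := by
    intro a b ha hb x
    simp [ha x, hb x]
  zero_mem' := by
    intro x
    simp
  smul_mem' := by
    intro c a ha x
    simp [ha x]

/-- Composition of morphisms of diagrams. -/
def comp {D : Diagram.{u, v, w₁} F k} {D' : Diagram.{u, v, w₂} F k} {D'' : Diagram.{u, v, w₃} F k}
    (ψ : Hom D' D'') (φ : Hom D D') : Hom D D'' :=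
  ⟨(ψ.1.1.comp φ.1.1, ψ.1.2.comp φ.1.2), fun x => by
    simp [φ.2 x, ψ.2 (φ.1.2 x)]⟩

/-- The diagram `𝒦(π) = (π|_{KZ}, π|_N, can)` of a smooth representation `π` of `G`. -/
def calK (π : SmoothRep.{u, v, w} F k) : Diagram.{u, v, w} F k where
  V₀ := π.V
  V₁ := π.V
  D₀ := res π.ρ (KZ F)
  D₁ := res π.ρ (N F)
  smooth₀ := π.smooth.res _
  smooth₁ := π.smooth.res _
  r := LinearMap.id
  equivariant := fun _ _ _ => rfl

/-- The morphism of diagrams `𝒦(φ) : 𝒦(π) → 𝒦(π')` of a `G`-equivariant map `φ : π → π'`. -/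
def calK.map {π : SmoothRep.{u, v, w₁} F k} {π' : SmoothRep.{u, v, w₂} F k}
    (φ : π.ρ.IntertwiningMap π'.ρ) : Hom (calK π) (calK π') :=
  ⟨(⟨φ.toLinearMap, fun g => φ.isIntertwining' g⟩, ⟨φ.toLinearMap, fun g => φ.isIntertwining' g⟩),
    fun _ => rfl⟩

/-- The subdiagram `(W₀, W₁, can)` of `𝒦(π)` given by a subrepresentation `W₀` of `π|_{KZ}` and a
subrepresentation `W₁` of `π|_N` with `W₁ ⊆ W₀`. -/
def sub (π : SmoothRep.{u, v, w} F k) (W₀ : Subrepresentation (res π.ρ (KZ F)))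
    (W₁ : Subrepresentation (res π.ρ (N F))) (h : W₁.toSubmodule ≤ W₀.toSubmodule) :
    Diagram.{u, v, w} F k where
  V₀ := W₀.toSubmodule
  V₁ := W₁.toSubmodule
  D₀ := W₀.toRepresentation
  D₁ := W₁.toRepresentation
  smooth₀ := (π.smooth.res _).toRepresentation _
  smooth₁ := (π.smooth.res _).toRepresentation _
  r := Submodule.inclusion h
  equivariant := fun _ _ _ => rfl

/-- The inclusion of a subdiagram of `𝒦(π)` into `𝒦(π)`. -/
def sub.incl (π : SmoothRep.{u, v, w} F k) (W₀ : Subrepresentation (res π.ρ (KZ F)))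
    (W₁ : Subrepresentation (res π.ρ (N F))) (h : W₁.toSubmodule ≤ W₀.toSubmodule) :
    Hom (sub π W₀ W₁ h) (calK π) :=
  ⟨(⟨W₀.toSubmodule.subtype, fun _ => rfl⟩, ⟨W₁.toSubmodule.subtype, fun _ => rfl⟩), fun _ => rfl⟩

end Diagram

end Diagrams

section Canonical

universe u v w

variable {F : Type u} [Field F] [ValuativeRel F] [TopologicalSpace F]
  {k : Type v} [Field k] (ϖ : 𝒪[F]) (hϖ : Irreducible ϖ) (π : SmoothRep.{u, v, w} F k)
  (σ : Subrepresentation (res π.ρ (KZ F)))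

/-- `I⁺(σ, π) = ⟨P⁺ · σ⟩`. -/
def Iplus : Submodule k π.V :=
  Submodule.span k {x | ∃ g ∈ Pplus F, ∃ v ∈ σ, π.ρ g v = x}

/-- `I⁻(σ, π) = Π · I⁺(σ, π)`. -/
def Iminus : Submodule k π.V :=
  (Iplus π σ).map (π.ρ (PiMat ϖ hϖ))

variable [IsNonarchimedeanLocalField F]

theorem center_Iplus {z : GL (Fin 2) F} (hz : z ∈ Subgroup.center (GL (Fin 2) F)) {x : π.V}
    (hx : x ∈ Iplus π σ) : π.ρ z x ∈ Iplus π σ := by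
  refine (Submodule.span_le (p := (Iplus π σ).comap (π.ρ z))).2 ?_ hx
  rintro _ ⟨g, hg, v, hv, rfl⟩
  refine Submodule.subset_span ⟨g, hg, π.ρ z v, ?_, ?_⟩
  · exact σ.apply_mem_toSubmodule ⟨z, Subgroup.mem_sup_right hz⟩ hv
  · rw [← Module.End.mul_apply, ← Module.End.mul_apply, ← map_mul, ← map_mul,
      Subgroup.mem_center_iff.1 hz g]

theorem iwahori_Iplus {h : GL (Fin 2) F} (hh : h ∈ iwahori F) {x : π.V}
    (hx : x ∈ Iplus π σ) : π.ρ h x ∈ Iplus π σ := by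
  refine (Submodule.span_le (p := (Iplus π σ).comap (π.ρ h))).2 ?_ hx
  rintro _ ⟨g, hg, v, hv, rfl⟩
  obtain ⟨y, hy, c, hc, e⟩ := iwahori_mul_Pplus hh hg
  refine Submodule.subset_span ⟨y, hy, π.ρ c v, ?_, ?_⟩
  · exact σ.apply_mem_toSubmodule ⟨c, Subgroup.mem_sup_left hc⟩ hv
  · rw [← Module.End.mul_apply, ← Module.End.mul_apply, ← map_mul, ← map_mul, e]

theorem PiMat_Iminus {x : π.V} (hx : x ∈ Iminus ϖ hϖ π σ) :
    π.ρ (PiMat ϖ hϖ) x ∈ Iplus π σ := by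
  obtain ⟨y, hy, rfl⟩ := hx
  rw [← Module.End.mul_apply, ← map_mul]
  exact center_Iplus π σ (PiMat_mul_self_mem_center hϖ) hy

theorem center_Iminus {z : GL (Fin 2) F} (hz : z ∈ Subgroup.center (GL (Fin 2) F)) {x : π.V}
    (hx : x ∈ Iminus ϖ hϖ π σ) : π.ρ z x ∈ Iminus ϖ hϖ π σ := by
  obtain ⟨y, hy, rfl⟩ := hx
  refine ⟨π.ρ z y, center_Iplus π σ hz hy, ?_⟩
  rw [← Module.End.mul_apply, ← Module.End.mul_apply, ← map_mul, ← map_mul,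
    Subgroup.mem_center_iff.1 hz]

theorem iwahori_Iminus {h : GL (Fin 2) F} (hh : h ∈ iwahori F) {x : π.V}
    (hx : x ∈ Iminus ϖ hϖ π σ) : π.ρ h x ∈ Iminus ϖ hϖ π σ := by
  obtain ⟨y, hy, rfl⟩ := hx
  have h' : (PiMat ϖ hϖ)⁻¹ * h * PiMat ϖ hϖ ∈ iwahori F := by
    have := ((inv_mem (PiMat_mem_N hϖ) : (PiMat ϖ hϖ)⁻¹ ∈ N F) h).1 hh
    rwa [inv_inv] at this
  refine ⟨_, iwahori_Iplus π σ h' hy, ?_⟩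
  rw [← Module.End.mul_apply, ← Module.End.mul_apply, ← map_mul, ← map_mul]
  congr 2
  group

/-- `D₁(π) = I⁺(σ, π) ∩ I⁻(σ, π)`, a subrepresentation of `π|_N`. -/
def D₁ : Subrepresentation (res π.ρ (N F)) where
  toSubmodule := Iplus π σ ⊓ Iminus ϖ hϖ π σ
  apply_mem_toSubmodule := by
    rintro ⟨g, hg⟩ x ⟨hx, hx'⟩
    change π.ρ g x ∈ _
    obtain ⟨z, hz, h, hh, rfl | rfl⟩ := exists_of_mem_N hϖ hg
    · rw [map_mul, Module.End.mul_apply]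
      exact ⟨center_Iplus π σ hz (iwahori_Iplus π σ hh hx),
        center_Iminus ϖ hϖ π σ hz (iwahori_Iminus ϖ hϖ π σ hh hx')⟩
    · rw [map_mul, map_mul, Module.End.mul_apply, Module.End.mul_apply]
      exact ⟨center_Iplus π σ hz (PiMat_Iminus ϖ hϖ π σ (iwahori_Iminus ϖ hϖ π σ hh hx')),
        center_Iminus ϖ hϖ π σ hz ⟨_, iwahori_Iplus π σ hh hx, rfl⟩⟩

/-- `D₀(π) = ⟨K · D₁(π)⟩`, a subrepresentation of `π|_{KZ}`. -/
def D₀ : Subrepresentation (res π.ρ (KZ F)) where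
  toSubmodule := Submodule.span k {x | ∃ g ∈ maxCompact F, ∃ v ∈ D₁ ϖ hϖ π σ, π.ρ g v = x}
  apply_mem_toSubmodule := by
    rintro ⟨g, hg⟩ x hx
    refine (Submodule.span_le (p := (Submodule.span k
      {x | ∃ g ∈ maxCompact F, ∃ v ∈ D₁ ϖ hϖ π σ, π.ρ g v = x}).comap (π.ρ g))).2 ?_ hx
    rintro _ ⟨c, hc, v, hv, rfl⟩
    obtain ⟨a, ha, z, hz, rfl⟩ := Subgroup.mem_sup_of_normal_right.1 hg
    refine Submodule.subset_span ⟨a * c, mul_mem ha hc, π.ρ z v, ?_, ?_⟩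
    · exact (D₁ ϖ hϖ π σ).apply_mem_toSubmodule ⟨z, center_le_N hz⟩ hv
    · rw [← Module.End.mul_apply, ← Module.End.mul_apply, ← map_mul, ← map_mul, mul_assoc,
        mul_assoc, Subgroup.mem_center_iff.1 hz c]

theorem D₁_le_D₀ : (D₁ ϖ hϖ π σ).toSubmodule ≤ (D₀ ϖ hϖ π σ).toSubmodule := fun v hv =>
  Submodule.subset_span ⟨1, one_mem _, v, hv, by simp⟩

/-- The canonical diagram `D(π) = (D₀(π), D₁(π), can)`, computed from the irreducible
subrepresentation `σ` of `π|_{KZ}`. -/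
def canonicalDiagram : Diagram.{u, v, w} F k :=
  Diagram.sub π (D₀ ϖ hϖ π σ) (D₁ ϖ hϖ π σ) (D₁_le_D₀ ϖ hϖ π σ)

/-- The inclusion `D(π) → 𝒦(π)`. -/
def canonicalDiagram.incl : Diagram.Hom (canonicalDiagram ϖ hϖ π σ) (Diagram.calK π) :=
  Diagram.sub.incl π (D₀ ϖ hϖ π σ) (D₁ ϖ hϖ π σ) (D₁_le_D₀ ϖ hϖ π σ)

end Canonical

end CanonicalDiagram

end

namespace CanonicalDiagram

open ValuativeRel Matrix

section Level

variable {F : Type*} [Field F] [ValuativeRel F]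

theorem valuation_mul_apply_le_one {A B : Matrix (Fin 2) (Fin 2) F}
    (hA : ∀ i j, valuation F (A i j) ≤ 1) (hB : ∀ i j, valuation F (B i j) ≤ 1) (i j : Fin 2) :
    valuation F ((A * B) i j) ≤ 1 := by
  rw [Matrix.mul_apply, Fin.sum_univ_two]
  refine Valuation.map_add_le _ ?_ ?_ <;> rw [map_mul]
  · exact mul_le_one' (hA _ _) (hB _ _)
  · exact mul_le_one' (hA _ _) (hB _ _)

theorem valuation_mul_apply_lt_one {A B : Matrix (Fin 2) (Fin 2) F}
    (hA : ∀ i j, valuation F (A i j) ≤ 1) (hB : ∀ i j, valuation F (B i j) < 1) (i j : Fin 2) :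
    valuation F ((A * B) i j) < 1 := by
  rw [Matrix.mul_apply, Fin.sum_univ_two]
  refine Valuation.map_add_lt _ ?_ ?_ <;> rw [map_mul]
  · exact (mul_le_of_le_one_left' (hA _ _)).trans_lt (hB _ _)
  · exact (mul_le_of_le_one_left' (hA _ _)).trans_lt (hB _ _)

/-- A matrix over `F` is primitive if it is integral and nonzero modulo `𝔭`. -/
def IsPrimitive (A : Matrix (Fin 2) (Fin 2) F) : Prop :=
  (∀ i j, valuation F (A i j) ≤ 1) ∧ ∃ i j, valuation F (A i j) = 1

theorem IsPrimitive.mul_left {A : Matrix (Fin 2) (Fin 2) F} (hA : IsPrimitive A)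
    {c : GL (Fin 2) F} (hc : c ∈ maxCompact F) : IsPrimitive (c.1 * A) := by
  have hle := valuation_mul_apply_le_one (mem_maxCompact.1 hc).1 hA.1
  refine ⟨hle, ?_⟩
  by_contra! H
  have h := valuation_mul_apply_lt_one (mem_maxCompact.1 (inv_mem hc)).1
    fun i j => lt_of_le_of_ne (hle i j) (H i j)
  rw [← Matrix.mul_assoc, ← GeneralLinearGroup.coe_mul, inv_mul_cancel, Units.val_one,
    Matrix.one_mul] at h
  obtain ⟨i, j, hij⟩ := hA.2
  exact (h i j).ne hij

theorem IsPrimitive.transpose {A : Matrix (Fin 2) (Fin 2) F} (hA : IsPrimitive A) :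
    IsPrimitive Aᵀ :=
  ⟨fun i j => hA.1 j i, let ⟨i, j, h⟩ := hA.2; ⟨j, i, h⟩⟩

theorem IsPrimitive.mul_right {A : Matrix (Fin 2) (Fin 2) F} (hA : IsPrimitive A)
    {c : GL (Fin 2) F} (hc : c ∈ maxCompact F) : IsPrimitive (A * c.1) := by
  have h := mem_maxCompact.1 hc
  let t : GL (Fin 2) F := GeneralLinearGroup.mkOfDetNeZero c.1ᵀ
    (by rw [Matrix.det_transpose]; exact GeneralLinearGroup.det_ne_zero c)
  have ht : t ∈ maxCompact F := mem_maxCompact.2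
    ⟨fun i j => h.1 j i, by
      change valuation F (c.1ᵀ).det = 1
      rw [Matrix.det_transpose]; exact h.2⟩
  have := (hA.transpose.mul_left ht).transpose
  change IsPrimitive (c.1ᵀ * Aᵀ)ᵀ at this
  rwa [Matrix.transpose_mul, Matrix.transpose_transpose, Matrix.transpose_transpose] at this

theorem exists_eq_smul_of_mem_KZ {h : GL (Fin 2) F} (hh : h ∈ KZ F) :
    ∃ c ∈ maxCompact F, ∃ a : F, a ≠ 0 ∧ h.1 = a • c.1 := by
  obtain ⟨c, hc, z, hz, rfl⟩ := Subgroup.mem_sup_of_normal_right.1 hh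
  obtain ⟨a, ha⟩ := GeneralLinearGroup.mem_center_iff_val_mem_range_scalar.1 hz
  refine ⟨c, hc, a, ?_, ?_⟩
  · rintro rfl
    have := GeneralLinearGroup.det_ne_zero z
    rw [← ha] at this
    simp at this
  · rw [GeneralLinearGroup.coe_mul, ← ha, Matrix.scalar_apply, ← Matrix.smul_one_eq_diagonal]
    simp

theorem mem_KZ_of_eq_smul {h c : GL (Fin 2) F} (hc : c ∈ maxCompact F) {a : F} (ha : a ≠ 0)
    (e : h.1 = a • c.1) : h ∈ KZ F := by
  have : h = c * GeneralLinearGroup.scalar (Fin 2) (Units.mk0 a ha) := by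
    apply Units.ext
    change h.1 = c.1 * Matrix.scalar (Fin 2) a
    rw [e, Matrix.scalar_apply, ← Matrix.smul_one_eq_diagonal]
    simp
  rw [this]
  exact mul_mem (Subgroup.mem_sup_left hc) (Subgroup.mem_sup_right
    (GeneralLinearGroup.mem_center_iff_val_mem_range_scalar.2 ⟨a, rfl⟩))

/-- `g` has level `n` if a scalar multiple of `g` is primitive with determinant of valuation `n`:
this says that the vertices `KZ` and `gKZ` of the tree of `G` are at distance `n`. -/
def HasLevel (ϖ : 𝒪[F]) (n : ℕ) (g : GL (Fin 2) F) : Prop :=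
  ∃ c : F, c ≠ 0 ∧ IsPrimitive (c • g.1) ∧
    valuation F c ^ 2 * valuation F g.1.det = valuation F (ϖ : F) ^ n

theorem HasLevel.mul_left {ϖ : 𝒪[F]} {n : ℕ} {g : GL (Fin 2) F} (hg : HasLevel ϖ n g)
    {c : GL (Fin 2) F} (hc : c ∈ maxCompact F) : HasLevel ϖ n (c * g) := by
  obtain ⟨a, ha, hp, hd⟩ := hg
  refine ⟨a, ha, ?_, ?_⟩
  · have := hp.mul_left hc
    rwa [Matrix.mul_smul] at this
  · rw [GeneralLinearGroup.coe_mul, Matrix.det_mul, map_mul, (mem_maxCompact.1 hc).2, one_mul, hd]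

theorem HasLevel.mul_right {ϖ : 𝒪[F]} {n : ℕ} {g : GL (Fin 2) F} (hg : HasLevel ϖ n g)
    {h : GL (Fin 2) F} (hh : h ∈ KZ F) : HasLevel ϖ n (g * h) := by
  obtain ⟨a, ha, hp, hd⟩ := hg
  obtain ⟨c, hc, b, hb, e⟩ := exists_eq_smul_of_mem_KZ hh
  have hvb : valuation F b ≠ 0 := by simpa using hb
  refine ⟨a * b⁻¹, mul_ne_zero ha (inv_ne_zero hb), ?_, ?_⟩
  · have := hp.mul_right hc
    rwa [GeneralLinearGroup.coe_mul, e, Matrix.mul_smul, smul_smul, mul_assoc, inv_mul_cancel₀ hb,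
      mul_one, ← Matrix.smul_mul]
  · rw [GeneralLinearGroup.coe_mul, Matrix.det_mul, e, Matrix.det_smul, Fintype.card_fin, map_mul,
      map_mul, map_mul, map_pow, map_inv₀, (mem_maxCompact.1 hc).2, mul_one, ← hd, mul_pow, inv_pow,
      mul_mul_mul_comm, mul_assoc, inv_mul_cancel₀ (pow_ne_zero _ hvb), mul_one]

theorem valuation_le_of_isPrimitive {g : Matrix (Fin 2) (Fin 2) F} {a b : F} (hb : b ≠ 0)
    (h : IsPrimitive (a • g)) (h' : IsPrimitive (b • g)) : valuation F b ≤ valuation F a := by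
  obtain ⟨i, j, hij⟩ := h'.2
  have h1 := h.1 i j
  have hvb : 0 < valuation F b := by simpa [zero_lt_iff] using hb
  simp only [Matrix.smul_apply, smul_eq_mul, map_mul] at hij h1
  by_contra! H
  obtain ⟨i, j, hij⟩ := h.2
  have h2 := h'.1 i j
  simp only [Matrix.smul_apply, smul_eq_mul, map_mul] at hij h2
  refine (h2.trans_eq hij.symm).not_gt (mul_lt_mul_of_pos_right H ?_)
  rw [zero_lt_iff]
  rintro h0
  rw [h0, mul_zero] at hij
  exact zero_ne_one hij

theorem HasLevel.unique {ϖ : 𝒪[F]} (h0 : valuation F (ϖ : F) ≠ 0) (h1 : valuation F (ϖ : F) < 1)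
    {m n : ℕ} {g : GL (Fin 2) F} (hm : HasLevel ϖ m g) (hn : HasLevel ϖ n g) : m = n := by
  obtain ⟨a, ha, hp, hd⟩ := hm
  obtain ⟨b, hb, hp', hd'⟩ := hn
  rw [le_antisymm (valuation_le_of_isPrimitive ha hp' hp)
    (valuation_le_of_isPrimitive hb hp hp'), hd'] at hd
  exact (pow_right_injective₀ (zero_lt_iff.2 h0) h1.ne hd).symm

/-- The normal form of a matrix representing a coset in `G/KZ`: it is integral and its `i`-th row
is `(0 1)`. -/
structure IsNormalForm (i : Fin 2) (g : GL (Fin 2) F) : Prop where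
  integral : ∀ i j, valuation F (g.1 i j) ≤ 1
  apply_zero : g.1 i 0 = 0
  apply_one : g.1 i 1 = 1

theorem exists_isNormalForm (g : GL (Fin 2) F) :
    ∃ h ∈ KZ F, ∃ i, IsNormalForm i (g * h) := by
  obtain ⟨⟨i, j⟩, hmax⟩ := Finite.exists_max fun x : Fin 2 × Fin 2 => valuation F (g.1 x.1 x.2)
  have hm : g.1 i j ≠ 0 := by
    intro h0
    have h (a b : Fin 2) : g.1 a b = 0 := by simpa [h0] using hmax (a, b)
    exact GeneralLinearGroup.det_ne_zero g (by rw [Matrix.det_fin_two]; simp [h])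
  set m := g.1 i j with hmdef
  have hvm : 0 < valuation F m := by simpa [zero_lt_iff] using hm
  have hle (a b : Fin 2) : valuation F (m⁻¹ * g.1 a b) ≤ 1 := by
    rw [map_mul, map_inv₀, inv_mul_le_iff₀ hvm, mul_one]
    exact hmax (a, b)
  have key (c : GL (Fin 2) F) (hc : c ∈ maxCompact F)
      (h0 : (g.1 * c.1) i 0 = 0) (h1 : (g.1 * c.1) i 1 = m) :
      ∃ h ∈ KZ F, ∃ i, IsNormalForm i (g * h) := by
    let h : GL (Fin 2) F := c * GeneralLinearGroup.scalar (Fin 2) (Units.mk0 _ (inv_ne_zero hm))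
    have eh : h.1 = m⁻¹ • c.1 := by
      change c.1 * Matrix.scalar (Fin 2) m⁻¹ = _
      rw [Matrix.scalar_apply, ← Matrix.smul_one_eq_diagonal]
      simp
    have e : (g * h).1 = m⁻¹ • (g.1 * c.1) := by
      rw [GeneralLinearGroup.coe_mul, eh, Matrix.mul_smul]
    refine ⟨h, mem_KZ_of_eq_smul hc (inv_ne_zero hm) eh, i, ?_, ?_, ?_⟩
    · rw [e, ← Matrix.smul_mul]
      exact valuation_mul_apply_le_one (by simpa using hle) (mem_maxCompact.1 hc).1
    · rw [e, Matrix.smul_apply, h0, smul_zero]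
    · rw [e, Matrix.smul_apply, h1, smul_eq_mul, inv_mul_cancel₀ hm]
  obtain rfl | rfl : j = 0 ∨ j = 1 := by fin_cases j <;> simp
  · refine key (GeneralLinearGroup.mkOfDetNeZero !![-(m⁻¹ * g.1 i 1), 1; 1, 0]
      (by simp [Matrix.det_fin_two])) (mem_maxCompact.2 ⟨?_, ?_⟩) ?_ ?_
    · simp only [Fin.forall_fin_two]
      change (valuation F (-(m⁻¹ * g.1 i 1)) ≤ 1 ∧ valuation F 1 ≤ 1) ∧
        valuation F 1 ≤ 1 ∧ valuation F 0 ≤ 1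
      rw [Valuation.map_neg]
      simpa using hle i 1
    · change valuation F (Matrix.det !![-(m⁻¹ * g.1 i 1), 1; 1, 0]) = 1
      simp [Matrix.det_fin_two]
    · change (g.1 * !![-(m⁻¹ * g.1 i 1), 1; 1, 0]) i 0 = 0
      rw [Matrix.mul_apply, Fin.sum_univ_two, ← hmdef]
      simp [hm]
    · change (g.1 * !![-(m⁻¹ * g.1 i 1), 1; 1, 0]) i 1 = m
      rw [Matrix.mul_apply, Fin.sum_univ_two, ← hmdef]
      simp
  · refine key (GeneralLinearGroup.mkOfDetNeZero !![1, 0; -(m⁻¹ * g.1 i 0), 1]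
      (by simp [Matrix.det_fin_two])) (mem_maxCompact.2 ⟨?_, ?_⟩) ?_ ?_
    · simp only [Fin.forall_fin_two]
      change (valuation F 1 ≤ 1 ∧ valuation F 0 ≤ 1) ∧
        valuation F (-(m⁻¹ * g.1 i 0)) ≤ 1 ∧ valuation F 1 ≤ 1
      rw [Valuation.map_neg]
      simpa using hle i 0
    · change valuation F (Matrix.det !![1, 0; -(m⁻¹ * g.1 i 0), 1]) = 1
      simp [Matrix.det_fin_two]
    · change (g.1 * !![1, 0; -(m⁻¹ * g.1 i 0), 1]) i 0 = 0
      rw [Matrix.mul_apply, Fin.sum_univ_two, ← hmdef]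
      simp [hm]
    · change (g.1 * !![1, 0; -(m⁻¹ * g.1 i 0), 1]) i 1 = m
      rw [Matrix.mul_apply, Fin.sum_univ_two, ← hmdef]
      simp

theorem IsNormalForm.hasLevel {ϖ : 𝒪[F]} {i : Fin 2} {g : GL (Fin 2) F} (hg : IsNormalForm i g)
    {n : ℕ} (hn : valuation F g.1.det = valuation F (ϖ : F) ^ n) : HasLevel ϖ n g :=
  ⟨1, one_ne_zero, by
    rw [one_smul]; exact ⟨hg.integral, i, 1, by rw [hg.apply_one, map_one]⟩, by simpa using hn⟩

theorem IsNormalForm.mul_Pplus {i : Fin 2} {g : GL (Fin 2) F} (hg : IsNormalForm i g)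
    {x : GL (Fin 2) F} (hx : x ∈ Pplus F) : IsNormalForm i (g * x) := by
  obtain ⟨hx0, hx1, hx2, hx3⟩ := hx
  refine ⟨?_, ?_, ?_⟩
  · refine valuation_mul_apply_le_one hg.integral ?_
    simp only [Fin.forall_fin_two, hx2, hx3]
    exact ⟨⟨hx0, hx1⟩, by simp⟩
  · rw [GeneralLinearGroup.coe_mul, Matrix.mul_apply, Fin.sum_univ_two, hg.apply_zero, hx2]
    simp
  · rw [GeneralLinearGroup.coe_mul, Matrix.mul_apply, Fin.sum_univ_two, hg.apply_zero,
      hg.apply_one, hx3]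
    simp

theorem det_of_mem_Pplus {x : GL (Fin 2) F} (hx : x ∈ Pplus F) : x.1.det = x.1 0 0 := by
  rw [Matrix.det_fin_two, hx.2.2.1, hx.2.2.2]; ring

theorem valuation_det_le_one {A : Matrix (Fin 2) (Fin 2) F}
    (hA : ∀ i j, valuation F (A i j) ≤ 1) : valuation F A.det ≤ 1 := by
  rw [Matrix.det_fin_two]
  refine Valuation.map_sub_le _ ?_ ?_ <;> rw [map_mul]
  · exact mul_le_one' (hA _ _) (hA _ _)
  · exact mul_le_one' (hA _ _) (hA _ _)

theorem IsNormalForm.mem_maxCompact {i : Fin 2} {g : GL (Fin 2) F} (hg : IsNormalForm i g)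
    (h : valuation F g.1.det = 1) : g ∈ maxCompact F :=
  CanonicalDiagram.mem_maxCompact.2 ⟨hg.integral, h⟩

theorem mem_maxCompact_of_mem_Pplus {x : GL (Fin 2) F} (hx : x ∈ Pplus F)
    (h : valuation F (x.1 0 0) = 1) : x ∈ maxCompact F := by
  refine mem_maxCompact.2 ⟨?_, by rwa [det_of_mem_Pplus hx]⟩
  simp only [Fin.forall_fin_two, hx.2.2.1, hx.2.2.2]
  exact ⟨⟨hx.1, hx.2.1⟩, by simp⟩

/-- The distance between the vertices `KZ` and `gKZ` of the tree of `G`. -/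
noncomputable def level (ϖ : 𝒪[F]) (g : GL (Fin 2) F) : ℕ := sInf {n | HasLevel ϖ n g}

theorem level_eq {ϖ : 𝒪[F]} (hϖ : Irreducible ϖ) {g : GL (Fin 2) F} {n : ℕ}
    (h : HasLevel ϖ n g) : level ϖ g = n :=
  HasLevel.unique (Valuation.integer.v_irreducible_pos hϖ).ne'
    (Valuation.integer.v_irreducible_lt_one hϖ) (Nat.sInf_mem (s := {n | HasLevel ϖ n g}) ⟨n, h⟩) h

theorem det_PiMat {ϖ : 𝒪[F]} (hϖ : Irreducible ϖ) : (PiMat ϖ hϖ).1.det = -(ϖ : F) := by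
  change Matrix.det !![0, 1; (ϖ : F), 0] = _
  simp [Matrix.det_fin_two]

theorem mul_PiMat_apply {ϖ : 𝒪[F]} (hϖ : Irreducible ϖ) (g : GL (Fin 2) F) (i : Fin 2) :
    (g * PiMat ϖ hϖ).1 i 0 = ϖ * g.1 i 1 ∧ (g * PiMat ϖ hϖ).1 i 1 = g.1 i 0 := by
  constructor
  · change (g.1 * !![0, 1; (ϖ : F), 0]) i 0 = _
    simp [Matrix.mul_apply, Fin.sum_univ_two, mul_comm]
  · change (g.1 * !![0, 1; (ϖ : F), 0]) i 1 = _
    simp [Matrix.mul_apply, Fin.sum_univ_two]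

/-- The elements of `K` outside `I` move `Π` into `P⁺I`. -/
theorem exists_mul_PiMat_eq {ϖ : 𝒪[F]} (hϖ : Irreducible ϖ) {c : GL (Fin 2) F}
    (hc : c ∈ maxCompact F) (hc' : c ∉ iwahori F) :
    ∃ x ∈ Pplus F, ∃ h ∈ iwahori F, c * PiMat ϖ hϖ = x * h := by
  have h1 : valuation F (ϖ : F) < 1 := Valuation.integer.v_irreducible_lt_one hϖ
  have hϖ0 : (ϖ : F) ≠ 0 := by simpa using hϖ.ne_zero
  obtain ⟨hK, hdet⟩ := mem_maxCompact.1 hc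
  have hu : valuation F (c.1 1 0) = 1 :=
    le_antisymm (hK 1 0) (not_lt.1 fun h => hc' ⟨hc, h⟩)
  have hu0 : c.1 1 0 ≠ 0 := by
    intro h; rw [h, map_zero] at hu; exact zero_ne_one hu
  have hD : c.1.det = c.1 0 0 * c.1 1 1 - c.1 0 1 * c.1 1 0 := Matrix.det_fin_two _
  let x : GL (Fin 2) F := GeneralLinearGroup.mkOfDetNeZero
    !![-(ϖ * c.1.det / c.1 1 0), c.1 0 0 / c.1 1 0; 0, 1] (by
      rw [Matrix.det_fin_two_of, mul_one, mul_zero, sub_zero, neg_ne_zero]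
      exact div_ne_zero (mul_ne_zero hϖ0 (GeneralLinearGroup.det_ne_zero c)) hu0)
  let h : GL (Fin 2) F := GeneralLinearGroup.mkOfDetNeZero
    !![1, 0; ϖ * c.1 1 1, c.1 1 0] (by simpa [Matrix.det_fin_two] using hu0)
  have hlt : valuation F (ϖ * c.1 1 1) < 1 := by
    rw [map_mul]
    exact (mul_le_of_le_one_right' (hK 1 1)).trans_lt h1
  refine ⟨x, ⟨?_, ?_, rfl, rfl⟩, h, ⟨mem_maxCompact.2 ⟨?_, ?_⟩, hlt⟩, ?_⟩
  · change valuation F (-(ϖ * c.1.det / c.1 1 0)) ≤ 1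
    rw [Valuation.map_neg, map_div₀, map_mul, hu, hdet, mul_one, div_one]
    exact h1.le
  · change valuation F (c.1 0 0 / c.1 1 0) ≤ 1
    rw [map_div₀, hu, div_one]
    exact hK 0 0
  · simp only [Fin.forall_fin_two]
    change (valuation F 1 ≤ 1 ∧ valuation F 0 ≤ 1) ∧
      valuation F (ϖ * c.1 1 1) ≤ 1 ∧ valuation F (c.1 1 0) ≤ 1
    exact ⟨by simp, hlt.le, hu.le⟩
  · change valuation F (Matrix.det !![1, 0; ϖ * c.1 1 1, c.1 1 0]) = 1
    simpa [Matrix.det_fin_two] using hu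
  · apply GeneralLinearGroup.ext
    intro i j
    fin_cases i <;> fin_cases j <;>
      simp [x, h, PiMat, Matrix.mul_apply, Fin.sum_univ_two, mul_comm]
    · rw [hD]
      field_simp
      ring
    · field_simp

end Level

section Tree

variable {F : Type*} [Field F] [ValuativeRel F] [TopologicalSpace F] [IsNonarchimedeanLocalField F]

theorem valuation_le_uniformizer {ϖ : 𝒪[F]} (hϖ : Irreducible ϖ) {x : F}
    (hx : valuation F x < 1) : valuation F x ≤ valuation F (ϖ : F) := by
  simpa using valuation_le_zpow hϖ (s := 0) (t := 0) (m := 1)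
    (by simpa using pow_lt_one₀ zero_le hx two_ne_zero) (by norm_num)

theorem exists_valuation_eq_pow {ϖ : 𝒪[F]} (hϖ : Irreducible ϖ) {x : F} (hx : x ≠ 0)
    (hx1 : valuation F x ≤ 1) : ∃ n : ℕ, valuation F x = valuation F (ϖ : F) ^ n := by
  have h0 : 0 < valuation F (ϖ : F) := Valuation.integer.v_irreducible_pos hϖ
  have h1 : valuation F (ϖ : F) < 1 := Valuation.integer.v_irreducible_lt_one hϖ
  obtain ⟨n, hn⟩ := exists_valuation_eq_zpow hϖ hx
  have : (0 : ℤ) ≤ n := by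
    rw [← zpow_le_zpow_iff_right_of_lt_one₀ h0 h1, ← hn, zpow_zero]
    exact hx1
  lift n to ℕ using this
  exact ⟨n, by simpa using hn⟩

theorem IsNormalForm.exists_level {ϖ : 𝒪[F]} (hϖ : Irreducible ϖ) {i : Fin 2} {g : GL (Fin 2) F}
    (hg : IsNormalForm i g) : ∃ n : ℕ, valuation F g.1.det = valuation F (ϖ : F) ^ n :=
  exists_valuation_eq_pow hϖ (GeneralLinearGroup.det_ne_zero g) (valuation_det_le_one hg.integral)

theorem exists_hasLevel {ϖ : 𝒪[F]} (hϖ : Irreducible ϖ) (g : GL (Fin 2) F) :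
    ∃ n, HasLevel ϖ n g := by
  obtain ⟨h, hh, i, hg⟩ := exists_isNormalForm g
  obtain ⟨n, hn⟩ := hg.exists_level hϖ
  refine ⟨n, ?_⟩
  have := (hg.hasLevel hn).mul_right (inv_mem hh)
  rwa [mul_inv_cancel_right] at this

theorem hasLevel_level {ϖ : 𝒪[F]} (hϖ : Irreducible ϖ) (g : GL (Fin 2) F) :
    HasLevel ϖ (level ϖ g) g := by
  obtain ⟨n, hn⟩ := exists_hasLevel hϖ g
  rwa [level_eq hϖ hn]

theorem level_mul_left {ϖ : 𝒪[F]} (hϖ : Irreducible ϖ) (g : GL (Fin 2) F) {c : GL (Fin 2) F}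
    (hc : c ∈ maxCompact F) : level ϖ (c * g) = level ϖ g :=
  level_eq hϖ ((hasLevel_level hϖ g).mul_left hc)

theorem level_mul_right {ϖ : 𝒪[F]} (hϖ : Irreducible ϖ) (g : GL (Fin 2) F) {h : GL (Fin 2) F}
    (hh : h ∈ KZ F) : level ϖ (g * h) = level ϖ g :=
  level_eq hϖ ((hasLevel_level hϖ g).mul_right hh)

theorem IsNormalForm.valuation_det {ϖ : 𝒪[F]} (hϖ : Irreducible ϖ) {i : Fin 2} {g : GL (Fin 2) F}
    (hg : IsNormalForm i g) : valuation F g.1.det = valuation F (ϖ : F) ^ level ϖ g := by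
  obtain ⟨n, hn⟩ := hg.exists_level hϖ
  rw [level_eq hϖ (hg.hasLevel hn), hn]

theorem mem_KZ_of_level_eq_zero {ϖ : 𝒪[F]} (hϖ : Irreducible ϖ) {g : GL (Fin 2) F}
    (hg : level ϖ g = 0) : g ∈ KZ F := by
  obtain ⟨h, hh, i, hn⟩ := exists_isNormalForm g
  have h1 := hn.mem_maxCompact (by
    rw [hn.valuation_det hϖ, level_mul_right hϖ g hh, hg, pow_zero])
  have := mul_mem (Subgroup.mem_sup_left h1 : g * h ∈ KZ F) (inv_mem hh)
  rwa [mul_inv_cancel_right] at this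

/-- An edge of the tree divides the vertices into two halves: `G = P⁺KZ ∪ ΠP⁺KZ`. -/
theorem exists_eq_Pplus_mul_or {ϖ : 𝒪[F]} (hϖ : Irreducible ϖ) (g : GL (Fin 2) F) :
    ∃ x ∈ Pplus F, ∃ h ∈ KZ F, g = x * h ∨ g = PiMat ϖ hϖ * x * h := by
  have h0 : 0 < valuation F (ϖ : F) := Valuation.integer.v_irreducible_pos hϖ
  have hϖ0 : (ϖ : F) ≠ 0 := by simpa using hϖ.ne_zero
  suffices H : ∀ g : GL (Fin 2) F, ∀ i, IsNormalForm i g →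
      ∃ x ∈ Pplus F, ∃ h ∈ KZ F, g = x * h ∨ g = PiMat ϖ hϖ * x * h by
    obtain ⟨h, hh, i, hn⟩ := exists_isNormalForm g
    obtain ⟨x, hx, h', hh', e⟩ := H _ i hn
    refine ⟨x, hx, h' * h⁻¹, mul_mem hh' (inv_mem hh), ?_⟩
    rwa [← mul_assoc, ← mul_assoc, eq_mul_inv_iff_mul_eq, eq_mul_inv_iff_mul_eq]
  clear g
  intro g i hg
  obtain rfl | rfl : i = 1 ∨ i = 0 := by fin_cases i <;> simp
  · exact ⟨g, ⟨hg.integral 0 0, hg.integral 0 1, hg.apply_zero, hg.apply_one⟩, 1, one_mem _,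
      Or.inl (mul_one g).symm⟩
  have hD : g.1.det = -g.1 1 0 := by
    rw [Matrix.det_fin_two, hg.apply_zero, hg.apply_one]; ring
  have hc0 : g.1 1 0 ≠ 0 := by
    rw [← neg_ne_zero, ← hD]; exact GeneralLinearGroup.det_ne_zero g
  rcases (hg.integral 1 1).eq_or_lt with hd | hd
  · have hd0 : g.1 1 1 ≠ 0 := by
      intro h; rw [h, map_zero] at hd; exact zero_ne_one hd
    let x : GL (Fin 2) F := GeneralLinearGroup.mkOfDetNeZero
      !![-(g.1 1 0 / g.1 1 1), (g.1 1 1)⁻¹; 0, 1] (by simp [Matrix.det_fin_two, hc0, hd0])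
    let h : GL (Fin 2) F := GeneralLinearGroup.mkOfDetNeZero
      !![1, 0; g.1 1 0, g.1 1 1] (by simp [Matrix.det_fin_two, hd0])
    refine ⟨x, ⟨?_, ?_, rfl, rfl⟩, h, Subgroup.mem_sup_left (mem_maxCompact.2 ⟨?_, ?_⟩), Or.inl ?_⟩
    · change valuation F (-(g.1 1 0 / g.1 1 1)) ≤ 1
      rw [Valuation.map_neg, map_div₀, hd, div_one]
      exact hg.integral 1 0
    · change valuation F (g.1 1 1)⁻¹ ≤ 1
      rw [map_inv₀, hd, inv_one]
    · simp only [Fin.forall_fin_two]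
      change (valuation F 1 ≤ 1 ∧ valuation F 0 ≤ 1) ∧
        valuation F (g.1 1 0) ≤ 1 ∧ valuation F (g.1 1 1) ≤ 1
      exact ⟨by simp, hg.integral 1 0, hg.integral 1 1⟩
    · change valuation F (Matrix.det !![1, 0; g.1 1 0, g.1 1 1]) = 1
      simpa [Matrix.det_fin_two] using hd
    · apply GeneralLinearGroup.ext
      intro i j
      fin_cases i <;> fin_cases j <;>
        simp [x, h, Matrix.mul_apply, Fin.sum_univ_two, hg.apply_zero, hg.apply_one, hd0]
      field_simp
      ring
  rcases (hg.integral 1 0).eq_or_lt with hc | hc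
  · exact ⟨1, one_mem _, g, Subgroup.mem_sup_left (hg.mem_maxCompact (by
      rw [hD, Valuation.map_neg, hc])), Or.inl (one_mul g).symm⟩
  · let x : GL (Fin 2) F := GeneralLinearGroup.mkOfDetNeZero
      !![(ϖ : F)⁻¹ * g.1 1 0, (ϖ : F)⁻¹ * g.1 1 1; 0, 1] (by simp [Matrix.det_fin_two, hc0, hϖ0])
    have key (y : F) (hy : valuation F y < 1) : valuation F ((ϖ : F)⁻¹ * y) ≤ 1 := by
      rw [map_mul, map_inv₀, inv_mul_le_iff₀ h0, mul_one]
      exact valuation_le_uniformizer hϖ hy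
    refine ⟨x, ⟨key _ hc, key _ hd, rfl, rfl⟩, 1, one_mem _, Or.inr ?_⟩
    apply GeneralLinearGroup.ext
    intro i j
    fin_cases i <;> fin_cases j <;>
      simp [x, PiMat, Matrix.mul_apply, Fin.sum_univ_two, hg.apply_zero, hg.apply_one, hϖ0]

theorem IsNormalForm.level_mul_PiMat_lt {ϖ : 𝒪[F]} (hϖ : Irreducible ϖ) {i : Fin 2}
    {g : GL (Fin 2) F} (hg : IsNormalForm i g) (hpos : level ϖ g ≠ 0) :
    level ϖ (g * PiMat ϖ hϖ) < level ϖ g := by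
  have h0 : 0 < valuation F (ϖ : F) := Valuation.integer.v_irreducible_pos hϖ
  have h1 : valuation F (ϖ : F) < 1 := Valuation.integer.v_irreducible_lt_one hϖ
  have hϖ0 : (ϖ : F) ≠ 0 := by simpa using hϖ.ne_zero
  obtain ⟨n, hn⟩ := Nat.exists_eq_succ_of_ne_zero hpos
  have hdet := hg.valuation_det hϖ
  have hcol (j : Fin 2) : valuation F (g.1 j 0) ≤ valuation F (ϖ : F) := by
    have : valuation F (g.1 j 0) ≤ valuation F g.1.det := by
      rw [Matrix.det_fin_two]
      have a0 := hg.apply_zero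
      have a1 := hg.apply_one
      fin_cases i <;> fin_cases j <;> simp_all
    refine this.trans ?_
    rw [hdet, hn, pow_succ]
    exact mul_le_of_le_one_left' (pow_le_one₀ zero_le h1.le)
  have key : HasLevel ϖ n (g * PiMat ϖ hϖ) := by
    refine ⟨(ϖ : F)⁻¹, inv_ne_zero hϖ0, ⟨?_, i, 0, ?_⟩, ?_⟩
    · intro a b
      obtain ⟨e0, e1⟩ := mul_PiMat_apply hϖ g a
      obtain rfl | rfl : b = 0 ∨ b = 1 := by fin_cases b <;> simp
      · rw [Matrix.smul_apply, e0, smul_eq_mul, inv_mul_cancel_left₀ hϖ0]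
        exact hg.integral a 1
      · rw [Matrix.smul_apply, e1, smul_eq_mul, map_mul, map_inv₀, inv_mul_le_iff₀ h0, mul_one]
        exact hcol a
    · rw [Matrix.smul_apply, (mul_PiMat_apply hϖ g i).1, smul_eq_mul, inv_mul_cancel_left₀ hϖ0,
        hg.apply_one, map_one]
    · rw [GeneralLinearGroup.coe_mul, Matrix.det_mul, det_PiMat, map_mul, Valuation.map_neg, hdet,
        hn, map_inv₀, pow_succ]
      field_simp
      rw [pow_succ']
  rw [level_eq hϖ key, hn]
  exact Nat.lt_succ_self n

/-- Seen from a vertex at distance `n` from `KZ`, all the vertices at distance at most `n` from `KZ`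
lie in the direction of `KZ`. -/
theorem IsNormalForm.mem_or_of_level_le {ϖ : 𝒪[F]} (hϖ : Irreducible ϖ) {i : Fin 2}
    {g y : GL (Fin 2) F} (hg : IsNormalForm i g) (hy : level ϖ y ≤ level ϖ g) :
    g⁻¹ * y ∈ KZ F ∨ ∃ x ∈ Pplus F, ∃ h ∈ KZ F, y = g * PiMat ϖ hϖ * x * h := by
  have h0 : 0 < valuation F (ϖ : F) := Valuation.integer.v_irreducible_pos hϖ
  have h1 : valuation F (ϖ : F) < 1 := Valuation.integer.v_irreducible_lt_one hϖ
  obtain ⟨x, hx, h, hh, e | e⟩ := exists_eq_Pplus_mul_or hϖ (g⁻¹ * y)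
  · left
    have hy' : y = g * x * h := by rw [mul_assoc, ← e, mul_inv_cancel_left]
    have hd := (hg.mul_Pplus hx).valuation_det hϖ
    rw [← level_mul_right hϖ _ hh, ← hy', GeneralLinearGroup.coe_mul, Matrix.det_mul, map_mul,
      hg.valuation_det hϖ, det_of_mem_Pplus hx] at hd
    have hx1 : valuation F (x.1 0 0) = 1 := by
      refine le_antisymm hx.1 ?_
      have h2 : valuation F (ϖ : F) ^ level ϖ g ≤ valuation F (ϖ : F) ^ level ϖ y :=
        pow_le_pow_of_le_one zero_le h1.le hy
      rw [← hd] at h2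
      by_contra! H
      exact (mul_lt_of_lt_one_right (pow_pos h0 _) H).not_ge h2
    rw [e]
    exact mul_mem (Subgroup.mem_sup_left (mem_maxCompact_of_mem_Pplus hx hx1)) hh
  · right
    refine ⟨x, hx, h, hh, ?_⟩
    rw [mul_assoc, mul_assoc, ← mul_assoc (PiMat ϖ hϖ), ← e, mul_inv_cancel_left]

end Tree

section HalfTree

universe u v w

variable {F : Type u} [Field F] [TopologicalSpace F]
  {k : Type v} [Field k] (π : SmoothRep.{u, v, w} F k)

theorem SmoothRep.mul_apply (g h : GL (Fin 2) F) (x : π.V) : π.ρ (g * h) x = π.ρ g (π.ρ h x) := by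
  rw [map_mul, Module.End.mul_apply]

theorem SmoothRep.inv_apply_self (g : GL (Fin 2) F) (x : π.V) : π.ρ g⁻¹ (π.ρ g x) = x := by
  rw [← π.mul_apply, inv_mul_cancel, map_one, Module.End.one_apply]

theorem SmoothRep.self_apply_inv (g : GL (Fin 2) F) (x : π.V) : π.ρ g (π.ρ g⁻¹ x) = x := by
  rw [← π.mul_apply, mul_inv_cancel, map_one, Module.End.one_apply]

theorem SmoothRep.apply_injective (g : GL (Fin 2) F) : Function.Injective (π.ρ g) :=
  Function.LeftInverse.injective (π.inv_apply_self g)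

theorem SmoothRep.span_translates_eq_top {π : SmoothRep.{u, v, w} F k} (hirr : π.ρ.IsIrreducible)
    {S : Set π.V} {x : π.V} (hxS : x ∈ S) (hx : x ≠ 0) :
    Submodule.span k {y | ∃ g, ∃ w ∈ S, π.ρ g w = y} = ⊤ := by
  let T : Subrepresentation π.ρ :=
    { toSubmodule := Submodule.span k {y | ∃ g, ∃ w ∈ S, π.ρ g w = y}
      apply_mem_toSubmodule := by
        intro h y hy
        refine (Submodule.span_le (p := (Submodule.span k
          {y | ∃ g, ∃ w ∈ S, π.ρ g w = y}).comap (π.ρ h))).2 ?_ hy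
        rintro _ ⟨g, w, hw, rfl⟩
        exact Submodule.subset_span ⟨h * g, w, hw, π.mul_apply h g w⟩ }
  have hT : T ≠ ⊥ := by
    intro h0
    have : x ∈ T := Submodule.subset_span ⟨1, x, hxS, by simp⟩
    rw [h0] at this
    exact hx ((Submodule.mem_bot k).1 this)
  exact congrArg Subrepresentation.toSubmodule ((eq_bot_or_eq_top T).resolve_left hT)

variable [ValuativeRel F] (ϖ : 𝒪[F]) (hϖ : Irreducible ϖ) (σ : Subrepresentation (res π.ρ (KZ F)))

theorem Pplus_Iplus {y : GL (Fin 2) F} (hy : y ∈ Pplus F) {x : π.V} (hx : x ∈ Iplus π σ) :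
    π.ρ y x ∈ Iplus π σ := by
  refine (Submodule.span_le (p := (Iplus π σ).comap (π.ρ y))).2 ?_ hx
  rintro _ ⟨g, hg, v, hv, rfl⟩
  exact Submodule.subset_span ⟨y * g, mul_mem hy hg, v, hv, π.mul_apply y g v⟩

theorem le_Iplus : σ.toSubmodule ≤ Iplus π σ := fun v hv =>
  Submodule.subset_span ⟨1, one_mem _, v, hv, by simp⟩

variable [IsNonarchimedeanLocalField F]

theorem D₀_le_Iplus : (D₀ ϖ hϖ π σ).toSubmodule ≤ Iplus π σ := by
  refine Submodule.span_le.2 ?_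
  rintro _ ⟨c, hc, v, hv, rfl⟩
  by_cases hc' : c ∈ iwahori F
  · exact iwahori_Iplus π σ hc' hv.1
  · obtain ⟨x, hx, h, hh, e⟩ := exists_mul_PiMat_eq hϖ hc hc'
    have hv' : π.ρ (PiMat ϖ hϖ)⁻¹ v ∈ D₁ ϖ hϖ π σ :=
      (D₁ ϖ hϖ π σ).apply_mem_toSubmodule ⟨_, inv_mem (PiMat_mem_N hϖ)⟩ hv
    rw [← π.self_apply_inv (PiMat ϖ hϖ) v, ← π.mul_apply, e, π.mul_apply]
    exact Pplus_Iplus π σ hx (iwahori_Iplus π σ hh hv'.1)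

end HalfTree

section Gluing

universe u v w w'

variable {F : Type u} [Field F] [ValuativeRel F] [TopologicalSpace F]
  {k : Type v} [Field k] (π : SmoothRep.{u, v, w} F k)
  {τ : Subrepresentation (res π.ρ (KZ F))} {X : Type w'} [AddCommGroup X] [Module k X]

/-- The graph of `g w ↦ θ g w` on the translate `gτ` of `τ`. -/
def localGraph (θ : GL (Fin 2) F → τ.toSubmodule →ₗ[k] X) (g : GL (Fin 2) F) :
    Submodule k (π.V × X) :=
  LinearMap.range ((π.ρ g ∘ₗ τ.toSubmodule.subtype).prod (θ g))

theorem localGraph_mul_le {θ : GL (Fin 2) F → τ.toSubmodule →ₗ[k] X}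
    (hθ : ∀ (g h : GL (Fin 2) F) (hh : h ∈ KZ F) (w : τ.toSubmodule),
      θ (g * h) w = θ g (τ.toRepresentation ⟨h, hh⟩ w))
    (g : GL (Fin 2) F) {h : GL (Fin 2) F} (hh : h ∈ KZ F) :
    localGraph π θ (g * h) ≤ localGraph π θ g := by
  rintro _ ⟨w, rfl⟩
  refine ⟨τ.toRepresentation ⟨h, hh⟩ w, Prod.ext ?_ (hθ g h hh w).symm⟩
  exact (π.mul_apply g h w).symm

theorem localGraph_mul {θ : GL (Fin 2) F → τ.toSubmodule →ₗ[k] X}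
    (hθ : ∀ (g h : GL (Fin 2) F) (hh : h ∈ KZ F) (w : τ.toSubmodule),
      θ (g * h) w = θ g (τ.toRepresentation ⟨h, hh⟩ w))
    (g : GL (Fin 2) F) {h : GL (Fin 2) F} (hh : h ∈ KZ F) :
    localGraph π θ (g * h) = localGraph π θ g := by
  refine le_antisymm (localGraph_mul_le π hθ g hh) ?_
  have := localGraph_mul_le π hθ (g * h) (inv_mem hh)
  rwa [mul_inv_cancel_right] at this

theorem localGraph_out {θ : GL (Fin 2) F → τ.toSubmodule →ₗ[k] X}
    (hθ : ∀ (g h : GL (Fin 2) F) (hh : h ∈ KZ F) (w : τ.toSubmodule),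
      θ (g * h) w = θ g (τ.toRepresentation ⟨h, hh⟩ w)) (g : GL (Fin 2) F) :
    localGraph π θ (g : GL (Fin 2) F ⧸ KZ F).out = localGraph π θ g := by
  obtain ⟨h, e⟩ := QuotientGroup.mk_out_eq_mul (KZ F) g
  rw [e, localGraph_mul π hθ g h.2]

variable [IsNonarchimedeanLocalField F] {ϖ : 𝒪[F]} (hϖ : Irreducible ϖ)

theorem level_out {ϖ : 𝒪[F]} (hϖ : Irreducible ϖ) (g : GL (Fin 2) F) :
    level ϖ (g : GL (Fin 2) F ⧸ KZ F).out = level ϖ g := by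
  obtain ⟨h, e⟩ := QuotientGroup.mk_out_eq_mul (KZ F) g
  rw [e, level_mul_right hϖ g h.2]

/-- Finitely many of the local graphs glue to a graph: the local graph at a vertex of maximal
distance from the origin meets the others only inside the local graph at the next vertex on the
way to the origin. -/
theorem snd_eq_zero_of_mem_iSup_localGraph
    {σ : Subrepresentation (res π.ρ (KZ F))} (hτ : τ.toSubmodule ≤ Iplus π σ)
    {θ : GL (Fin 2) F → τ.toSubmodule →ₗ[k] X}
    (hθ : ∀ (g h : GL (Fin 2) F) (hh : h ∈ KZ F) (w : τ.toSubmodule),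
      θ (g * h) w = θ g (τ.toRepresentation ⟨h, hh⟩ w))
    (hedge : ∀ (g : GL (Fin 2) F) (w : τ.toSubmodule), (w : π.V) ∈ Iminus ϖ hϖ π σ →
      ∃ w' : τ.toSubmodule, π.ρ (PiMat ϖ hϖ) w' = w ∧ θ (g * PiMat ϖ hϖ) w' = θ g w)
    (S : Finset (GL (Fin 2) F ⧸ KZ F)) {u : π.V × X}
    (hu : u ∈ ⨆ x ∈ S, localGraph π θ x.out) (hu0 : u.1 = 0) : u.2 = 0 := by
  classical
  induction hn : ∑ x ∈ S, (level ϖ x.out + 1) using Nat.strong_induction_on generalizing S u with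
  | _ n ih =>
  rcases S.eq_empty_or_nonempty with rfl | hS
  · simp at hu
    simp [hu]
  obtain ⟨x, hxS, hmax⟩ := S.exists_max_image (fun x => level ϖ x.out) hS
  obtain ⟨h, hh, i, hg⟩ := exists_isNormalForm x.out
  set g := x.out * h with hgdef
  have hgx : (g : GL (Fin 2) F ⧸ KZ F) = x := by
    rw [hgdef, QuotientGroup.mk_mul_of_mem _ hh, QuotientGroup.out_eq']
  have hlg : level ϖ g = level ϖ x.out := level_mul_right hϖ _ hh
  have hEg : localGraph π θ x.out = localGraph π θ g := (localGraph_mul π hθ _ hh).symm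
  clear_value g
  rw [← Finset.insert_erase hxS, Finset.iSup_insert, hEg] at hu
  obtain ⟨_, ⟨w, rfl⟩, b, hb, rfl⟩ := Submodule.mem_sup.1 hu
  have hmove : ∀ y ∈ S.erase x, ∃ p ∈ Pplus F, ∃ h ∈ KZ F,
      y.out = g * PiMat ϖ hϖ * p * h := by
    intro y hy
    rcases hg.mem_or_of_level_le hϖ (hlg ▸ hmax y (Finset.mem_of_mem_erase hy)) with hc | hc
    · refine absurd ?_ (Finset.ne_of_mem_erase hy)
      rw [← hgx, ← QuotientGroup.out_eq' y]
      exact (QuotientGroup.eq.2 hc).symm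
    · exact hc
  have hb1 : b.1 ∈ (Iminus ϖ hϖ π σ).map (π.ρ g) := by
    have : (⨆ y ∈ S.erase x, localGraph π θ y.out) ≤
        ((Iminus ϖ hϖ π σ).map (π.ρ g)).comap (LinearMap.fst k π.V X) := by
      refine iSup₂_le fun y hy => ?_
      obtain ⟨p, hp, h', hh', e⟩ := hmove y hy
      rintro _ ⟨v, rfl⟩
      refine ⟨_, ⟨_, Pplus_Iplus π σ hp (hτ (τ.apply_mem_toSubmodule ⟨h', hh'⟩ v.2)), rfl⟩, ?_⟩
      change π.ρ g (π.ρ (PiMat ϖ hϖ) (π.ρ p (π.ρ h' v))) = π.ρ y.out v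
      rw [e, π.mul_apply, π.mul_apply, π.mul_apply]
    exact this hb
  have hsum : π.ρ g w + b.1 = 0 := hu0
  have hw : (w : π.V) ∈ Iminus ϖ hϖ π σ := by
    have h1 : π.ρ g w ∈ (Iminus ϖ hϖ π σ).map (π.ρ g) := by
      rw [eq_neg_of_add_eq_zero_left hsum]; exact neg_mem hb1
    obtain ⟨w', hw', e⟩ := h1
    rwa [← π.apply_injective g e]
  by_cases h0 : level ϖ g = 0
  · have hempty : S.erase x = ∅ := by
      refine Finset.eq_empty_of_forall_notMem fun y hy => Finset.ne_of_mem_erase hy ?_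
      have hy0 : level ϖ y.out = 0 :=
        Nat.le_zero.1 (h0 ▸ hlg ▸ hmax y (Finset.mem_of_mem_erase hy))
      rw [← hgx, ← QuotientGroup.out_eq' y]
      exact QuotientGroup.eq.2 (mul_mem (inv_mem (mem_KZ_of_level_eq_zero hϖ hy0))
        (mem_KZ_of_level_eq_zero hϖ h0))
    rw [hempty] at hb
    have hb0 : b = 0 := by simpa using hb
    rw [hb0] at hsum ⊢
    have hw0 : w = 0 := by
      refine Subtype.ext (π.apply_injective g ?_)
      simpa using hsum
    simp [hw0]
  · obtain ⟨w', e1, e2⟩ := hedge g w hw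
    have ha : (π.ρ g w, θ g w) ∈ localGraph π θ
        ((g * PiMat ϖ hϖ : GL (Fin 2) F) : GL (Fin 2) F ⧸ KZ F).out := by
      rw [localGraph_out π hθ]
      refine ⟨w', Prod.ext ?_ e2⟩
      change π.ρ (g * PiMat ϖ hϖ) w' = π.ρ g w
      rw [π.mul_apply, e1]
    have hlt := hg.level_mul_PiMat_lt hϖ h0
    refine ih _ ?_ (insert ((g * PiMat ϖ hϖ : GL (Fin 2) F) : GL (Fin 2) F ⧸ KZ F) (S.erase x))
      (u := (π.ρ g w, θ g w) + b) ?_ hsum rfl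
    · rw [← hn, ← Finset.add_sum_erase S _ hxS, ← hlg]
      refine lt_of_le_of_lt (b := (level ϖ (g * PiMat ϖ hϖ) + 1) +
        ∑ y ∈ S.erase x, (level ϖ y.out + 1)) ?_ (by gcongr)
      by_cases hmem : ((g * PiMat ϖ hϖ : GL (Fin 2) F) : GL (Fin 2) F ⧸ KZ F) ∈ S.erase x
      · rw [Finset.insert_eq_of_mem hmem]; omega
      · rw [Finset.sum_insert hmem, level_out hϖ]
    · rw [Finset.iSup_insert]
      exact add_mem (Submodule.mem_sup_left ha) (Submodule.mem_sup_right hb)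

/-- A linear map on `π` can be defined on the translates of a subspace `τ` of `I⁺(π)` if it is well
defined at the vertices and at the edges of the tree. -/
theorem exists_linearMap_apply_eq
    {σ : Subrepresentation (res π.ρ (KZ F))} (hτ : τ.toSubmodule ≤ Iplus π σ)
    {θ : GL (Fin 2) F → τ.toSubmodule →ₗ[k] X}
    (hθ : ∀ (g h : GL (Fin 2) F) (hh : h ∈ KZ F) (w : τ.toSubmodule),
      θ (g * h) w = θ g (τ.toRepresentation ⟨h, hh⟩ w))
    (hedge : ∀ (g : GL (Fin 2) F) (w : τ.toSubmodule), (w : π.V) ∈ Iminus ϖ hϖ π σ →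
      ∃ w' : τ.toSubmodule, π.ρ (PiMat ϖ hϖ) w' = w ∧ θ (g * PiMat ϖ hϖ) w' = θ g w)
    (hspan : Submodule.span k {x | ∃ g, ∃ w ∈ τ, π.ρ g w = x} = ⊤) :
    ∃ Θ : π.V →ₗ[k] X, ∀ g (w : τ.toSubmodule), Θ (π.ρ g w) = θ g w := by
  let E : Submodule k (π.V × X) := ⨆ x : GL (Fin 2) F ⧸ KZ F, localGraph π θ x.out
  have hmem (g : GL (Fin 2) F) (w : τ.toSubmodule) : (π.ρ g w, θ g w) ∈ E := by
    refine Submodule.mem_iSup_of_mem (g : GL (Fin 2) F ⧸ KZ F) ?_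
    rw [localGraph_out π hθ]
    exact ⟨w, rfl⟩
  let f : E →ₗ[k] π.V := LinearMap.fst k π.V X ∘ₗ E.subtype
  have hinj : Function.Injective f := by
    rw [injective_iff_map_eq_zero]
    rintro ⟨u, hu⟩ hu0
    obtain ⟨S, hS⟩ := Submodule.exists_finset_of_mem_iSup _ hu
    have hu0' : u.1 = 0 := hu0
    exact Subtype.ext (Prod.ext hu0'
      (snd_eq_zero_of_mem_iSup_localGraph π hϖ hτ hθ hedge S hS hu0'))
  have hsurj : Function.Surjective f := by
    rw [← LinearMap.range_eq_top, eq_top_iff, ← hspan, Submodule.span_le]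
    rintro _ ⟨g, w, hw, rfl⟩
    exact ⟨⟨_, hmem g ⟨w, hw⟩⟩, rfl⟩
  refine ⟨LinearMap.snd k π.V X ∘ₗ E.subtype ∘ₗ
    (LinearEquiv.ofBijective f ⟨hinj, hsurj⟩).symm.toLinearMap, fun g w => ?_⟩
  have : (LinearEquiv.ofBijective f ⟨hinj, hsurj⟩).symm (π.ρ g w) = ⟨_, hmem g w⟩ := by
    rw [LinearEquiv.symm_apply_eq]; rfl
  simp [this]

end Gluing

section FixedVector

theorem exists_ne_zero_fixed_of_zmodModule {p : ℕ} [Fact p.Prime] {k H V : Type*} [Field k]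
    [Group H] [AddCommGroup V] [Module k V] [Module (ZMod p) V]
    (ρ : Representation k H V) (N : Subgroup H) [N.Normal]
    [N.FiniteIndex] (hN : ∀ h : H, ∃ m : ℕ, h ^ p ^ m ∈ N) {v : V} (hv : v ≠ 0)
    (hfix : ∀ n ∈ N, ρ n v = v) :
    ∃ w ∈ Submodule.span k (Set.range fun h => ρ h v), w ≠ 0 ∧ ∀ h, ρ h w = w := by
  have hpV (x : V) : p • x = 0 := by
    rw [← Nat.cast_smul_eq_nsmul (ZMod p), CharP.cast_eq_zero, zero_smul]
  let X : Set V := Set.range fun h => ρ h v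
  let A : Submodule (ZMod p) V := Submodule.span (ZMod p) X
  have hX : X.Finite := by
    have : X ⊆ Set.range fun q : H ⧸ N => ρ q.out v := by
      rintro _ ⟨h, rfl⟩
      obtain ⟨n, e⟩ := QuotientGroup.mk_out_eq_mul N h
      refine ⟨(h : H ⧸ N), ?_⟩
      change ρ (h : H ⧸ N).out v = ρ h v
      rw [e, map_mul, Module.End.mul_apply, hfix n n.2]
    exact (Set.finite_range _).subset this
  have : Module.Finite (ZMod p) ↥A := Module.Finite.span_of_finite (ZMod p) hX
  have : Finite ↥A := Module.finite_of_finite (ZMod p)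
  have hvA : v ∈ A := Submodule.subset_span ⟨1, by simp⟩
  have hstable (h : H) : ∀ x ∈ A, ρ h x ∈ A := by
    intro x hx
    refine Submodule.span_induction (p := fun x _ => ρ h x ∈ A) ?_ ?_ ?_ ?_ hx
    · rintro _ ⟨g, rfl⟩
      exact Submodule.subset_span ⟨h * g, by simp⟩
    · simp
    · intro x y _ _ hx hy
      rw [map_add]; exact add_mem hx hy
    · intro c x _ hx
      rw [← ZMod.natCast_zmod_val c, Nat.cast_smul_eq_nsmul, map_nsmul]
      exact nsmul_mem hx _
  have htriv : ∀ n ∈ N, ∀ x ∈ A, ρ n x = x := by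
    intro n hn x hx
    refine Submodule.span_induction (p := fun x _ => ρ n x = x) ?_ ?_ ?_ ?_ hx
    · rintro _ ⟨g, rfl⟩
      have h1 := hfix (g⁻¹ * n * g) (by simpa using (‹N.Normal›.conj_mem n hn g⁻¹))
      have h2 : n * g = g * (g⁻¹ * n * g) := by group
      change ρ n (ρ g v) = ρ g v
      rw [← Module.End.mul_apply, ← map_mul, h2, map_mul, Module.End.mul_apply, h1]
    · simp
    · intro x y _ _ hx hy
      rw [map_add, hx, hy]
    · intro c x _ hx
      rw [← ZMod.natCast_zmod_val c, Nat.cast_smul_eq_nsmul, map_nsmul, hx]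
  let _ : MulAction H A :=
    { smul := fun h x => ⟨ρ h x, hstable h x x.2⟩
      one_smul := fun x => Subtype.ext (by change ρ 1 (x : V) = x; simp)
      mul_smul := fun g h x => Subtype.ext (by
        change ρ (g * h) (x : V) = ρ g (ρ h x); simp) }
  have hP : IsPGroup p (MulAction.toPermHom H A).range := by
    intro x
    obtain ⟨h, hh⟩ := x.2
    obtain ⟨m, hm⟩ := hN h
    refine ⟨m, Subtype.ext ?_⟩
    rw [Subgroup.coe_pow, ← hh, ← map_pow]
    ext x
    exact htriv _ hm x x.2
  have hdvd : p ∣ Nat.card A := by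
    have h1 : addOrderOf (⟨v, hvA⟩ : A) = p :=
      addOrderOf_eq_prime (Subtype.ext (hpV v)) (fun h => hv (congrArg Subtype.val h))
    exact h1.symm.dvd.trans (addOrderOf_dvd_natCard _)
  obtain ⟨b, hb, hb0⟩ := hP.exists_fixed_point_of_prime_dvd_card_of_fixed_point A hdvd
    (a := 0) (by
      rintro ⟨_, h, rfl⟩
      exact Subtype.ext (map_zero (ρ h)))
  refine ⟨b, ?_, fun h => hb0 (Subtype.ext h.symm), fun h => ?_⟩
  · refine Submodule.span_induction (p := fun x _ => x ∈ Submodule.span k X) ?_ ?_ ?_ ?_ b.2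
    · exact fun x hx => Submodule.subset_span hx
    · exact zero_mem _
    · exact fun x y _ _ hx hy => add_mem hx hy
    · intro c x _ hx
      rw [← ZMod.natCast_zmod_val c, Nat.cast_smul_eq_nsmul]
      exact nsmul_mem hx _
  · exact congrArg Subtype.val (hb ⟨_, h, rfl⟩)

/-- A group acting through a finite `p`-quotient on a nonzero vector space of characteristic `p` has
a nonzero fixed vector. -/
theorem exists_ne_zero_fixed {p : ℕ} [Fact p.Prime] {k H V : Type*} [Field k] [CharP k p] [Group H]
    [AddCommGroup V] [Module k V] (ρ : Representation k H V) (N : Subgroup H) [N.Normal]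
    [N.FiniteIndex] (hN : ∀ h : H, ∃ m : ℕ, h ^ p ^ m ∈ N) {v : V} (hv : v ≠ 0)
    (hfix : ∀ n ∈ N, ρ n v = v) :
    ∃ w ∈ Submodule.span k (Set.range fun h => ρ h v), w ≠ 0 ∧ ∀ h, ρ h w = w := by
  let _ : Module (ZMod p) V := AddCommGroup.zmodModule (n := p) fun x => by
    rw [← Nat.cast_smul_eq_nsmul k, CharP.cast_eq_zero, zero_smul]
  exact exists_ne_zero_fixed_of_zmodModule (p := p) ρ N hN hv hfix

end FixedVector

section Congruence

variable {F : Type*} [Field F] [ValuativeRel F]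

/-- The kernel of `GL₂(𝒪) → GL₂(𝒪/ϖⁿ)`. -/
noncomputable def congruenceSubgroup (ϖ : 𝒪[F]) (n : ℕ) : Subgroup (GL (Fin 2) 𝒪[F]) :=
  (GeneralLinearGroup.map (n := Fin 2) (Ideal.Quotient.mk (Ideal.span {ϖ} ^ n))).ker

instance (ϖ : 𝒪[F]) (n : ℕ) : (congruenceSubgroup ϖ n).Normal :=
  MonoidHom.normal_ker _

theorem mem_congruenceSubgroup {ϖ : 𝒪[F]} {n : ℕ} {g : GL (Fin 2) 𝒪[F]} :
    g ∈ congruenceSubgroup ϖ n ↔ ∃ Y : Matrix (Fin 2) (Fin 2) 𝒪[F], g.1 = 1 + ϖ ^ n • Y := by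
  have key : g ∈ congruenceSubgroup ϖ n ↔ ∀ i j, ϖ ^ n ∣ (g.1 - 1) i j := by
    rw [congruenceSubgroup, MonoidHom.mem_ker, GeneralLinearGroup.ext_iff]
    refine forall₂_congr fun i j => ?_
    rw [← Ideal.mem_span_singleton, ← Ideal.span_singleton_pow, ← Ideal.Quotient.eq_zero_iff_mem,
      Matrix.sub_apply, map_sub, sub_eq_zero]
    have : Ideal.Quotient.mk (Ideal.span {ϖ} ^ n) ((1 : Matrix (Fin 2) (Fin 2) 𝒪[F]) i j) =
        (1 : Matrix (Fin 2) (Fin 2) (𝒪[F] ⧸ Ideal.span {ϖ} ^ n)) i j := by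
      simp only [Matrix.one_apply]; split_ifs <;> simp
    rw [this]
    rfl
  rw [key]
  constructor
  · intro h
    choose Y hY using h
    refine ⟨Matrix.of Y, ?_⟩
    rw [← sub_eq_iff_eq_add']
    ext1 i j
    exact hY i j
  · rintro ⟨Y, hY⟩ i j
    rw [hY, add_sub_cancel_left]
    exact ⟨Y i j, rfl⟩

theorem congruenceSubgroup_antitone (ϖ : 𝒪[F]) : Antitone (congruenceSubgroup ϖ) := by
  intro m n hmn g hg
  obtain ⟨Y, hY⟩ := mem_congruenceSubgroup.1 hg
  refine mem_congruenceSubgroup.2 ⟨ϖ ^ (n - m) • Y, ?_⟩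
  rw [hY, smul_smul, ← pow_add, Nat.add_sub_cancel' hmn]

theorem pow_prime_mem_congruenceSubgroup {p : ℕ} (hp : p.Prime) {ϖ : 𝒪[F]}
    (hϖp : ϖ ∣ (p : 𝒪[F])) {n : ℕ} {g : GL (Fin 2) 𝒪[F]}
    (hg : g ∈ congruenceSubgroup ϖ (n + 1)) : g ^ p ∈ congruenceSubgroup ϖ (n + 2) := by
  obtain ⟨Y, hY⟩ := mem_congruenceSubgroup.1 hg
  obtain ⟨c, hc⟩ := hϖp
  obtain ⟨r, hr⟩ := (Commute.one_left (ϖ ^ (n + 1) • Y)).exists_add_pow_prime_eq hp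
  refine mem_congruenceSubgroup.2 ⟨ϖ ^ ((n + 1) * p - (n + 2)) • Y ^ p + c • (Y * r), ?_⟩
  have hle : n + 2 ≤ (n + 1) * p := by nlinarith [hp.two_le]
  have e : ((p : ℕ) : Matrix (Fin 2) (Fin 2) 𝒪[F]) = (ϖ * c) • 1 := by
    rw [← hc, ← nsmul_one, ← Nat.cast_smul_eq_nsmul 𝒪[F]]
  rw [Units.val_pow_eq_pow_val, hY, hr, one_pow, smul_pow, ← pow_mul, e, mul_one, smul_add,
    smul_smul, ← pow_add, Nat.add_sub_cancel' hle, add_assoc, smul_one_mul, smul_mul_assoc,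
    smul_mul_assoc, smul_smul, smul_smul]
  congr 3
  ring

theorem pow_prime_pow_mem_congruenceSubgroup {p : ℕ} (hp : p.Prime) {ϖ : 𝒪[F]}
    (hϖp : ϖ ∣ (p : 𝒪[F])) {g : GL (Fin 2) 𝒪[F]} (hg : g ∈ congruenceSubgroup ϖ 1) (m : ℕ) :
    g ^ p ^ m ∈ congruenceSubgroup ϖ (m + 1) := by
  induction m with
  | zero => simpa using hg
  | succ m ih =>
    rw [pow_succ, pow_mul]
    exact pow_prime_mem_congruenceSubgroup hp hϖp ih

/-- The embedding of `GL₂(𝒪)` into `G`. -/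
noncomputable abbrev integralMap (F : Type*) [Field F] [ValuativeRel F] :
    GL (Fin 2) 𝒪[F] →* GL (Fin 2) F :=
  GeneralLinearGroup.map (n := Fin 2) (algebraMap 𝒪[F] F)

theorem integralMap_mem_maxCompact (g : GL (Fin 2) 𝒪[F]) : integralMap F g ∈ maxCompact F :=
  ⟨g, rfl⟩

variable [TopologicalSpace F] [IsNonarchimedeanLocalField F]

theorem uniformizer_dvd_prime {p : ℕ} [CharP 𝓀[F] p] {ϖ : 𝒪[F]} (hϖ : Irreducible ϖ) :
    ϖ ∣ (p : 𝒪[F]) := by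
  rw [← Ideal.mem_span_singleton, ← hϖ.maximalIdeal_eq, ← IsLocalRing.residue_eq_zero_iff,
    map_natCast]
  exact CharP.cast_eq_zero _ _

theorem finiteIndex_congruenceSubgroup {ϖ : 𝒪[F]} (hϖ : Irreducible ϖ) (n : ℕ) :
    (congruenceSubgroup ϖ n).FiniteIndex := by
  have : Finite (𝒪[F] ⧸ Ideal.span {ϖ}) := by
    rw [← hϖ.maximalIdeal_eq]
    exact inferInstanceAs (Finite 𝓀[F])
  have : Finite (𝒪[F] ⧸ Ideal.span {ϖ} ^ n) :=
    Ideal.finite_quotient_pow ⟨{ϖ}, by simp⟩ n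
  have : Finite (GL (Fin 2) (𝒪[F] ⧸ Ideal.span {ϖ} ^ n)) :=
    Finite.of_injective (fun g => g.1) Units.val_injective
  exact Subgroup.finiteIndex_ker _

theorem tendsto_zero_of_valuation_le {ϖ : 𝒪[F]} (hϖ : Irreducible ϖ) {x : ℕ → F}
    (hx : ∀ n, valuation F (x n) ≤ valuation F (ϖ : F) ^ n) :
    Filter.Tendsto x Filter.atTop (nhds 0) := by
  have h0 : 0 < valuation F (ϖ : F) := Valuation.integer.v_irreducible_pos hϖ
  have h1 : valuation F (ϖ : F) < 1 := Valuation.integer.v_irreducible_lt_one hϖ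
  rw [(IsValuativeTopology.hasBasis_nhds_zero' F).tendsto_right_iff]
  intro γ hγ
  obtain ⟨y, rfl⟩ := valuation_surjective γ
  obtain ⟨m, hm⟩ := exists_valuation_eq_zpow hϖ (x := y) (by simpa using hγ)
  filter_upwards [Filter.eventually_ge_atTop (m.toNat + 1)] with n hn
  refine (hx n).trans_lt ?_
  rw [hm, ← zpow_natCast, zpow_lt_zpow_iff_right_of_lt_one₀ h0 h1]
  omega

/-- Every open subgroup of `G` contains a congruence subgroup. -/
theorem exists_congruenceSubgroup_le {ϖ : 𝒪[F]} (hϖ : Irreducible ϖ) {U : Subgroup (GL (Fin 2) F)}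
    (hU : IsOpen (U : Set (GL (Fin 2) F))) :
    ∃ n, ∀ g ∈ congruenceSubgroup ϖ n, integralMap F g ∈ U := by
  by_contra! H
  choose g hg hgU using H
  have key (f : ℕ → GL (Fin 2) 𝒪[F]) (hf : ∀ n, f n ∈ congruenceSubgroup ϖ n) :
      Filter.Tendsto (fun n => (integralMap F (f n)).1) Filter.atTop (nhds 1) := by
    refine tendsto_pi_nhds.2 fun i => tendsto_pi_nhds.2 fun j => ?_
    rw [← tendsto_sub_nhds_zero_iff]
    refine tendsto_zero_of_valuation_le hϖ fun n => ?_
    obtain ⟨Y, hY⟩ := mem_congruenceSubgroup.1 (hf n)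
    have : (integralMap F (f n)).1 i j - (1 : Matrix (Fin 2) (Fin 2) F) i j
        = (ϖ : F) ^ n * (Y i j : F) := by
      have e : (integralMap F (f n)).1 i j = algebraMap 𝒪[F] F ((f n).1 i j) := rfl
      rw [e, hY, Matrix.add_apply, map_add, Matrix.smul_apply, smul_eq_mul, map_mul, map_pow,
        add_sub_right_comm]
      have e' : algebraMap 𝒪[F] F ((1 : Matrix (Fin 2) (Fin 2) 𝒪[F]) i j) =
          (1 : Matrix (Fin 2) (Fin 2) F) i j := by
        simp only [Matrix.one_apply]; split_ifs <;> simp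
      rw [e', sub_self, zero_add]
      rfl
    rw [this, map_mul, map_pow]
    exact mul_le_of_le_one_right' (Y i j).2
  have hlim : Filter.Tendsto (fun n => integralMap F (g n)) Filter.atTop (nhds 1) := by
    rw [Units.isEmbedding_embedProduct.tendsto_nhds_iff]
    refine Filter.Tendsto.prodMk_nhds (key g hg) ?_
    refine (MulOpposite.continuous_op.tendsto _).comp ?_
    have := key (fun n => (g n)⁻¹) fun n => inv_mem (hg n)
    simpa only [map_inv, inv_one] using! this
  obtain ⟨n, hn⟩ := (hlim.eventually (hU.mem_nhds (one_mem U))).exists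
  exact hgU n hn

end Congruence

section SmoothVectors

universe u v w

variable {F : Type u} [Field F] [ValuativeRel F] [TopologicalSpace F] [IsNonarchimedeanLocalField F]
  {k : Type v} [Field k] (π : SmoothRep.{u, v, w} F k)

theorem SmoothRep.exists_congruenceSubgroup_fixes {ϖ : 𝒪[F]} (hϖ : Irreducible ϖ) (v : π.V) :
    ∃ n, ∀ g ∈ congruenceSubgroup ϖ n, π.ρ (integralMap F g) v = v := by
  obtain ⟨U, hU, h⟩ := π.smooth v
  obtain ⟨n, hn⟩ := exists_congruenceSubgroup_le hϖ hU
  exact ⟨n, fun g hg => h _ (hn g hg)⟩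

/-- The first congruence subgroup is a pro-`p` group: it has fixed vectors in characteristic `p`. -/
theorem SmoothRep.exists_fixed_of_ne_bot {p : ℕ} [Fact p.Prime] [CharP 𝓀[F] p] [CharP k p]
    {ϖ : 𝒪[F]} (hϖ : Irreducible ϖ) {W : Submodule k π.V} (hW : W ≠ ⊥)
    (hstable : ∀ g ∈ congruenceSubgroup ϖ 1, ∀ x ∈ W, π.ρ (integralMap F g) x ∈ W) :
    ∃ w ∈ W, w ≠ 0 ∧ ∀ g ∈ congruenceSubgroup ϖ 1, π.ρ (integralMap F g) w = w := by
  obtain ⟨v, hvW, hv⟩ := Submodule.exists_mem_ne_zero_of_ne_bot hW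
  obtain ⟨n, hn⟩ := π.exists_congruenceSubgroup_fixes hϖ v
  let ρ : Representation k (congruenceSubgroup ϖ 1) π.V :=
    π.ρ.comp ((integralMap F).comp (congruenceSubgroup ϖ 1).subtype)
  have := finiteIndex_congruenceSubgroup hϖ n
  obtain ⟨w, hw, hw0, hfix⟩ := exists_ne_zero_fixed (p := p) ρ
    ((congruenceSubgroup ϖ n).subgroupOf (congruenceSubgroup ϖ 1))
    (fun h => ⟨n, congruenceSubgroup_antitone ϖ (Nat.le_succ n)
      (pow_prime_pow_mem_congruenceSubgroup Fact.out (uniformizer_dvd_prime hϖ) h.2 n)⟩) hv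
    (fun g hg => hn g hg)
  refine ⟨w, ?_, hw0, fun g hg => hfix ⟨g, hg⟩⟩
  refine Submodule.span_le.2 ?_ hw
  rintro _ ⟨g, rfl⟩
  exact hstable g g.2 v hvW

theorem exists_ne_zero_of_isIrreducible {H V : Type*} [Group H] [AddCommGroup V] [Module k V]
    {ρ : Representation k H V} {σ : Subrepresentation ρ} (hσ : σ.toRepresentation.IsIrreducible) :
    ∃ x ∈ σ, x ≠ 0 := by
  by_contra! h0
  have : Subsingleton σ.toSubmodule := ⟨fun x y => Subtype.ext ((h0 x x.2).trans (h0 y y.2).symm)⟩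
  have : (⊥ : Subrepresentation σ.toRepresentation) = ⊤ :=
    Subrepresentation.toSubmodule_injective (Subsingleton.elim _ _)
  exact bot_ne_top this

theorem SmoothRep.fixed_of_isIrreducible {p : ℕ} [Fact p.Prime] [CharP 𝓀[F] p] [CharP k p]
    {ϖ : 𝒪[F]} (hϖ : Irreducible ϖ) {σ : Subrepresentation (res π.ρ (KZ F))}
    (hσ : σ.toRepresentation.IsIrreducible) {g : GL (Fin 2) 𝒪[F]}
    (hg : g ∈ congruenceSubgroup ϖ 1) {x : π.V} (hx : x ∈ σ) : π.ρ (integralMap F g) x = x := by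
  let T : Subrepresentation σ.toRepresentation :=
    { toSubmodule :=
        { carrier := {x | ∀ g ∈ congruenceSubgroup ϖ 1, π.ρ (integralMap F g) (x : π.V) = x}
          add_mem' := fun {x y} hx hy g hg => by
            rw [Submodule.coe_add, map_add, hx g hg, hy g hg]
          zero_mem' := fun g _ => by simp
          smul_mem' := fun c x hx g hg => by
            rw [Submodule.coe_smul, map_smul, hx g hg] }
      apply_mem_toSubmodule := by
        rintro ⟨h, hh⟩ x hx g hg
        obtain ⟨_, ⟨a, rfl⟩, z, hz, rfl⟩ := Subgroup.mem_sup_of_normal_right.1 hh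
        change π.ρ (integralMap F g) (π.ρ (integralMap F a * z) x) = π.ρ (integralMap F a * z) x
        have hg' : a⁻¹ * g * a ∈ congruenceSubgroup ϖ 1 := by
          simpa using (inferInstance : (congruenceSubgroup ϖ 1).Normal).conj_mem g hg a⁻¹
        have e : integralMap F g * (integralMap F a * z)
            = integralMap F a * z * integralMap F (a⁻¹ * g * a) := by
          rw [mul_assoc _ z, ← Subgroup.mem_center_iff.1 hz, map_mul, map_mul, map_inv]
          group
        rw [← π.mul_apply, e, π.mul_apply, hx _ hg'] }
  have hT : T ≠ ⊥ := by
    have hne : σ.toSubmodule ≠ ⊥ :=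
      (Submodule.ne_bot_iff _).2 (exists_ne_zero_of_isIrreducible hσ)
    obtain ⟨w, hw, hw0, hfix⟩ := π.exists_fixed_of_ne_bot (p := p) hϖ hne fun g _ x hx =>
      σ.apply_mem_toSubmodule
        ⟨_, Subgroup.mem_sup_left (integralMap_mem_maxCompact g)⟩ hx
    intro h0
    have : (⟨w, hw⟩ : σ.toSubmodule) ∈ T := hfix
    rw [h0] at this
    exact hw0 (congrArg Subtype.val ((Submodule.mem_bot k).1 this))
  have hmem : (⟨x, hx⟩ : σ.toSubmodule) ∈ T := by
    rw [(eq_bot_or_eq_top T).resolve_left hT]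
    exact Submodule.mem_top
  exact hmem g hg

/-- A smooth representation of `G` with a central character has irreducible subrepresentations
under `KZ`. -/
theorem SmoothRep.exists_isIrreducible [Nontrivial π.V] (hcent : HasCentralCharacter π.ρ)
    {ϖ : 𝒪[F]} (hϖ : Irreducible ϖ) :
    ∃ σ : Subrepresentation (res π.ρ (KZ F)), σ.toRepresentation.IsIrreducible := by
  obtain ⟨χ, hχ⟩ := hcent
  obtain ⟨v, hv⟩ := exists_ne (0 : π.V)
  obtain ⟨n, hn⟩ := π.exists_congruenceSubgroup_fixes hϖ v
  have := finiteIndex_congruenceSubgroup hϖ n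
  let X : Set π.V := Set.range fun q : GL (Fin 2) 𝒪[F] ⧸ congruenceSubgroup ϖ n =>
    π.ρ (integralMap F q.out) v
  have hX (g : GL (Fin 2) 𝒪[F]) : π.ρ (integralMap F g) v ∈ X := by
    obtain ⟨c, e⟩ := QuotientGroup.mk_out_eq_mul (congruenceSubgroup ϖ n) g
    refine ⟨(g : GL (Fin 2) 𝒪[F] ⧸ congruenceSubgroup ϖ n), ?_⟩
    change π.ρ (integralMap F (g : GL (Fin 2) 𝒪[F] ⧸ congruenceSubgroup ϖ n).out) v = _
    rw [e, map_mul, π.mul_apply, hn c c.2]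
  let σ₀ : Subrepresentation (res π.ρ (KZ F)) :=
    { toSubmodule := Submodule.span k X
      apply_mem_toSubmodule := by
        rintro ⟨h, hh⟩ x hx
        obtain ⟨_, ⟨a, rfl⟩, z, hz, rfl⟩ := Subgroup.mem_sup_of_normal_right.1 hh
        change π.ρ (integralMap F a * z) x ∈ _
        rw [π.mul_apply, hχ ⟨z, hz⟩ x, map_smul]
        refine Submodule.smul_mem _ _ ?_
        refine (Submodule.span_le (p := (Submodule.span k X).comap (π.ρ (integralMap F a)))).2 ?_ hx
        rintro _ ⟨q, rfl⟩
        refine Submodule.subset_span ?_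
        change π.ρ (integralMap F a) (π.ρ (integralMap F q.out) v) ∈ X
        rw [← π.mul_apply, ← map_mul]
        exact hX _ }
  have hfin₀ : Module.Finite k σ₀.toSubmodule :=
    Module.Finite.span_of_finite k (Set.finite_range _)
  have hne₀ : σ₀.toSubmodule ≠ ⊥ := by
    refine Submodule.ne_bot_iff _ |>.2 ⟨v, Submodule.subset_span ?_, hv⟩
    simpa using hX 1
  let P : ℕ → Prop := fun d => ∃ σ : Subrepresentation (res π.ρ (KZ F)),
    Module.Finite k σ.toSubmodule ∧ σ.toSubmodule ≠ ⊥ ∧ Module.finrank k σ.toSubmodule = d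
  classical
  have hP : ∃ d, P d := ⟨_, σ₀, hfin₀, hne₀, rfl⟩
  obtain ⟨σ, hfin, hne, hd⟩ := Nat.find_spec hP
  refine ⟨σ, { exists_pair_ne := ⟨⊥, ⊤, ?_⟩, eq_bot_or_eq_top := fun T => ?_ }⟩
  · intro h
    have h' : (⊥ : Submodule k σ.toSubmodule) = ⊤ := congrArg Subrepresentation.toSubmodule h
    obtain ⟨x, hx, hx0⟩ := Submodule.exists_mem_ne_zero_of_ne_bot hne
    have : (⟨x, hx⟩ : σ.toSubmodule) ∈ (⊥ : Submodule k σ.toSubmodule) := h' ▸ Submodule.mem_top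
    exact hx0 (congrArg Subtype.val ((Submodule.mem_bot k).1 this))
  · by_cases hT : T.toSubmodule = ⊥
    · exact Or.inl (Subrepresentation.toSubmodule_injective hT)
    right
    apply Subrepresentation.toSubmodule_injective
    let T' : Subrepresentation (res π.ρ (KZ F)) :=
      { toSubmodule := T.toSubmodule.map σ.toSubmodule.subtype
        apply_mem_toSubmodule := by
          rintro h _ ⟨x, hx, rfl⟩
          exact ⟨_, T.apply_mem_toSubmodule h hx, rfl⟩ }
    have hrank : Module.finrank k T'.toSubmodule = Module.finrank k T.toSubmodule :=
      (Submodule.equivMapOfInjective _ Subtype.val_injective _).finrank_eq.symm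
    have hmin : Nat.find hP ≤ Module.finrank k T.toSubmodule := by
      refine Nat.find_min' hP ⟨T', ?_, ?_, hrank⟩
      · exact inferInstanceAs (Module.Finite k (T.toSubmodule.map σ.toSubmodule.subtype))
      · intro h0
        exact hT (Submodule.map_injective_of_injective σ.toSubmodule.subtype_injective
          (h0.trans (Submodule.map_bot _).symm))
    exact Submodule.eq_top_of_finrank_eq
      (le_antisymm (Submodule.finrank_le _) (hd ▸ hmin))

end SmoothVectors

section Mirabolic

variable {F : Type*} [Field F] [ValuativeRel F]

/-- The matrix `(ϖⁿ t; 0 1)`. -/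
noncomputable def mirabolicMat {ϖ : 𝒪[F]} (hϖ : Irreducible ϖ) (n : ℤ) (t : F) : GL (Fin 2) F :=
  GeneralLinearGroup.mkOfDetNeZero !![(ϖ : F) ^ n, t; 0, 1] (by
    have := hϖ.ne_zero
    simpa [Matrix.det_fin_two] using zpow_ne_zero n (by simpa using this))

theorem mirabolicMat_mul {ϖ : 𝒪[F]} (hϖ : Irreducible ϖ) (m n : ℤ) (s t : F) :
    mirabolicMat hϖ m s * mirabolicMat hϖ n t =
      mirabolicMat hϖ (m + n) ((ϖ : F) ^ m * t + s) := by
  have hϖ0 : (ϖ : F) ≠ 0 := by simpa using hϖ.ne_zero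
  apply GeneralLinearGroup.ext
  intro i j
  fin_cases i <;> fin_cases j <;>
    simp [mirabolicMat, Matrix.mul_apply, Fin.sum_univ_two, zpow_add₀ hϖ0]

theorem mirabolicMat_zero_zero {ϖ : 𝒪[F]} (hϖ : Irreducible ϖ) :
    mirabolicMat hϖ 0 0 = 1 := by
  apply GeneralLinearGroup.ext
  intro i j
  fin_cases i <;> fin_cases j <;> simp [mirabolicMat]

/-- The group of the matrices `(ϖⁿ t; 0 1)`. -/
noncomputable def mirabolic {ϖ : 𝒪[F]} (hϖ : Irreducible ϖ) : Subgroup (GL (Fin 2) F) where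
  carrier := {g | ∃ n t, mirabolicMat hϖ n t = g}
  one_mem' := ⟨0, 0, mirabolicMat_zero_zero hϖ⟩
  mul_mem' := by
    rintro _ _ ⟨m, s, rfl⟩ ⟨n, t, rfl⟩
    exact ⟨_, _, (mirabolicMat_mul hϖ m n s t).symm⟩
  inv_mem' := by
    rintro _ ⟨n, t, rfl⟩
    have hϖ0 : (ϖ : F) ≠ 0 := by simpa using hϖ.ne_zero
    refine ⟨-n, -((ϖ : F) ^ (-n) * t), ?_⟩
    rw [eq_inv_iff_mul_eq_one, mirabolicMat_mul, neg_add_cancel, add_neg_cancel,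
      mirabolicMat_zero_zero]

theorem exists_upperRightHom_eq {ϖ : 𝒪[F]} (hϖ : Irreducible ϖ) {g : GL (Fin 2) F}
    (hg : g ∈ mirabolic hϖ) (hg' : g ∈ KZ F) :
    ∃ t : 𝒪[F], integralMap F (GeneralLinearGroup.upperRightHom t) = g := by
  have h0 : 0 < valuation F (ϖ : F) := Valuation.integer.v_irreducible_pos hϖ
  have h1 : valuation F (ϖ : F) < 1 := Valuation.integer.v_irreducible_lt_one hϖ
  obtain ⟨n, t, rfl⟩ := hg
  obtain ⟨c, hc, a, ha, e⟩ := exists_eq_smul_of_mem_KZ hg'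
  obtain ⟨hK, hdet⟩ := mem_maxCompact.1 hc
  have e00 : (ϖ : F) ^ n = a * c.1 0 0 := congrFun₂ e 0 0
  have e01 : t = a * c.1 0 1 := congrFun₂ e 0 1
  have e10 : 0 = a * c.1 1 0 := congrFun₂ e 1 0
  have e11 : 1 = a * c.1 1 1 := congrFun₂ e 1 1
  have hc10 : c.1 1 0 = 0 := by simpa [ha] using e10.symm
  rw [Matrix.det_fin_two, hc10, mul_zero, sub_zero, map_mul] at hdet
  have hc00 : valuation F (c.1 0 0) = 1 :=
    le_antisymm (hK 0 0) (hdet ▸ mul_le_of_le_one_right' (hK 1 1))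
  rw [hc00, one_mul] at hdet
  have hva : valuation F a = 1 := by
    have := congrArg (valuation F) e11
    rw [map_mul, hdet, mul_one, map_one] at this
    exact this.symm
  have hn : n = 0 := by
    have := congrArg (valuation F) e00
    rw [map_mul, hva, hc00, mul_one, map_zpow₀] at this
    exact (zpow_eq_one_iff_right₀ h0.le h1.ne).1 this
  subst hn
  have ht : valuation F t ≤ 1 := by
    rw [e01, map_mul, hva, one_mul]
    exact hK 0 1
  refine ⟨⟨t, ht⟩, ?_⟩
  apply GeneralLinearGroup.ext
  intro i j
  fin_cases i <;> fin_cases j <;> simp [mirabolicMat, GeneralLinearGroup.upperRightHom]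
  rfl

theorem valuation_div_le_one {x y : F} (h : valuation F x ≤ valuation F y) :
    valuation F (x / y) ≤ 1 := by
  rw [map_div₀]
  exact div_le_one_of_le₀ h zero_le

theorem exists_mul_apply_one (g : GL (Fin 2) F) :
    ∃ h ∈ KZ F, (g * h).1 1 0 = 0 ∧ (g * h).1 1 1 = 1 := by
  have hD : g.1.det = g.1 0 0 * g.1 1 1 - g.1 0 1 * g.1 1 0 := Matrix.det_fin_two _
  have key (c : GL (Fin 2) F) (hc : c ∈ maxCompact F) (m : F) (hm : m ≠ 0)
      (h0 : (g.1 * c.1) 1 0 = 0) (h1 : (g.1 * c.1) 1 1 = m) :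
      ∃ h ∈ KZ F, (g * h).1 1 0 = 0 ∧ (g * h).1 1 1 = 1 := by
    let h : GL (Fin 2) F := c * GeneralLinearGroup.scalar (Fin 2) (Units.mk0 _ (inv_ne_zero hm))
    have eh : h.1 = m⁻¹ • c.1 := by
      change c.1 * Matrix.scalar (Fin 2) m⁻¹ = _
      rw [Matrix.scalar_apply, ← Matrix.smul_one_eq_diagonal]
      simp
    have e : (g * h).1 = m⁻¹ • (g.1 * c.1) := by
      rw [GeneralLinearGroup.coe_mul, eh, Matrix.mul_smul]
    refine ⟨h, mem_KZ_of_eq_smul hc (inv_ne_zero hm) eh, ?_, ?_⟩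
    · rw [e, Matrix.smul_apply, h0, smul_zero]
    · rw [e, Matrix.smul_apply, h1, smul_eq_mul, inv_mul_cancel₀ hm]
  have hne : ¬(g.1 1 0 = 0 ∧ g.1 1 1 = 0) := by
    rintro ⟨h1, h2⟩
    exact GeneralLinearGroup.det_ne_zero g (by rw [hD, h1, h2]; ring)
  rcases le_total (valuation F (g.1 1 1)) (valuation F (g.1 1 0)) with hle | hle
  · have hm : g.1 1 0 ≠ 0 := fun h => hne ⟨h, by simpa [h] using hle⟩
    refine key (GeneralLinearGroup.mkOfDetNeZero !![-(g.1 1 1 / g.1 1 0), 1; 1, 0]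
      (by simp [Matrix.det_fin_two])) (mem_maxCompact.2 ⟨?_, ?_⟩) (g.1 1 0) hm ?_ ?_
    · simp only [Fin.forall_fin_two]
      change (valuation F (-(g.1 1 1 / g.1 1 0)) ≤ 1 ∧ valuation F 1 ≤ 1) ∧
        valuation F 1 ≤ 1 ∧ valuation F 0 ≤ 1
      rw [Valuation.map_neg]
      simpa using valuation_div_le_one hle
    · change valuation F (Matrix.det !![-(g.1 1 1 / g.1 1 0), 1; 1, 0]) = 1
      simp [Matrix.det_fin_two]
    · change (g.1 * !![-(g.1 1 1 / g.1 1 0), 1; 1, 0]) 1 0 = 0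
      rw [Matrix.mul_apply, Fin.sum_univ_two]
      simp [mul_div_cancel₀ _ hm]
    · change (g.1 * !![-(g.1 1 1 / g.1 1 0), 1; 1, 0]) 1 1 = _
      rw [Matrix.mul_apply, Fin.sum_univ_two]
      simp
  · have hm : g.1 1 1 ≠ 0 := fun h => hne ⟨by simpa [h] using hle, h⟩
    refine key (GeneralLinearGroup.mkOfDetNeZero !![1, 0; -(g.1 1 0 / g.1 1 1), 1]
      (by simp [Matrix.det_fin_two])) (mem_maxCompact.2 ⟨?_, ?_⟩) (g.1 1 1) hm ?_ ?_
    · simp only [Fin.forall_fin_two]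
      change (valuation F 1 ≤ 1 ∧ valuation F 0 ≤ 1) ∧
        valuation F (-(g.1 1 0 / g.1 1 1)) ≤ 1 ∧ valuation F 1 ≤ 1
      rw [Valuation.map_neg]
      simpa using valuation_div_le_one hle
    · change valuation F (Matrix.det !![1, 0; -(g.1 1 0 / g.1 1 1), 1]) = 1
      simp [Matrix.det_fin_two]
    · change (g.1 * !![1, 0; -(g.1 1 0 / g.1 1 1), 1]) 1 0 = 0
      rw [Matrix.mul_apply, Fin.sum_univ_two]
      simp [mul_div_cancel₀ _ hm]
    · change (g.1 * !![1, 0; -(g.1 1 0 / g.1 1 1), 1]) 1 1 = _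
      rw [Matrix.mul_apply, Fin.sum_univ_two]
      simp

theorem level_mirabolicMat {ϖ : 𝒪[F]} (hϖ : Irreducible ϖ) (n : ℕ) :
    level ϖ (mirabolicMat hϖ n 0) = n := by
  have h1 : valuation F (ϖ : F) < 1 := Valuation.integer.v_irreducible_lt_one hϖ
  refine level_eq hϖ (IsNormalForm.hasLevel (i := 1) ⟨?_, rfl, rfl⟩ ?_)
  · simp only [Fin.forall_fin_two]
    change (valuation F ((ϖ : F) ^ (n : ℤ)) ≤ 1 ∧ valuation F 0 ≤ 1) ∧
      valuation F 0 ≤ 1 ∧ valuation F 1 ≤ 1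
    simpa using pow_le_one₀ zero_le h1.le
  · change valuation F (Matrix.det !![(ϖ : F) ^ (n : ℤ), 0; 0, 1]) = _
    simp [Matrix.det_fin_two]

variable [TopologicalSpace F] [IsNonarchimedeanLocalField F]

/-- The Iwasawa decomposition. -/
theorem exists_mirabolic_mul_KZ {ϖ : 𝒪[F]} (hϖ : Irreducible ϖ) (g : GL (Fin 2) F) :
    ∃ b ∈ mirabolic hϖ, b⁻¹ * g ∈ KZ F := by
  have h0 : 0 < valuation F (ϖ : F) := Valuation.integer.v_irreducible_pos hϖ
  have hϖ0 : (ϖ : F) ≠ 0 := by simpa using hϖ.ne_zero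
  obtain ⟨h, hh, e0, e1⟩ := exists_mul_apply_one g
  have ha : (g * h).1 0 0 ≠ 0 := by
    intro h0
    refine GeneralLinearGroup.det_ne_zero (g * h) ?_
    rw [Matrix.det_fin_two, h0, e0]
    ring
  obtain ⟨n, hn⟩ := exists_valuation_eq_zpow hϖ ha
  have hϖn : (ϖ : F) ^ n ≠ 0 := zpow_ne_zero n hϖ0
  let d : GL (Fin 2) F := GeneralLinearGroup.mkOfDetNeZero
    !![(g * h).1 0 0 / (ϖ : F) ^ n, 0; 0, 1] (by
      rw [Matrix.det_fin_two_of, mul_one, mul_zero, sub_zero]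
      exact div_ne_zero ha hϖn)
  have hval : valuation F ((g * h).1 0 0 / (ϖ : F) ^ n) = 1 := by
    rw [map_div₀, map_zpow₀, hn, div_self (zpow_ne_zero n h0.ne')]
  have hd : d ∈ maxCompact F := by
    refine mem_maxCompact.2 ⟨?_, ?_⟩
    · simp only [Fin.forall_fin_two]
      change (valuation F ((g * h).1 0 0 / (ϖ : F) ^ n) ≤ 1 ∧ valuation F 0 ≤ 1) ∧
        valuation F 0 ≤ 1 ∧ valuation F 1 ≤ 1
      simpa using hval.le
    · change valuation F (Matrix.det !![(g * h).1 0 0 / (ϖ : F) ^ n, 0; 0, 1]) = 1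
      rw [Matrix.det_fin_two_of, mul_one, mul_zero, sub_zero, hval]
  have e : g * h = mirabolicMat hϖ n ((g * h).1 0 1) * d := by
    apply GeneralLinearGroup.ext
    intro i j
    rw [GeneralLinearGroup.coe_mul (mirabolicMat _ _ _), Matrix.mul_apply, Fin.sum_univ_two]
    change _ = (!![(ϖ : F) ^ n, (g * h).1 0 1; 0, 1] : Matrix (Fin 2) (Fin 2) F) i 0 *
      (!![(g * h).1 0 0 / (ϖ : F) ^ n, 0; 0, 1] : Matrix (Fin 2) (Fin 2) F) 0 j +
      (!![(ϖ : F) ^ n, (g * h).1 0 1; 0, 1] : Matrix (Fin 2) (Fin 2) F) i 1 *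
      (!![(g * h).1 0 0 / (ϖ : F) ^ n, 0; 0, 1] : Matrix (Fin 2) (Fin 2) F) 1 j
    revert i j
    simp only [Fin.forall_fin_two, e0, e1]
    simp [mul_div_cancel₀ _ hϖn]
  refine ⟨_, ⟨n, (g * h).1 0 1, rfl⟩, ?_⟩
  have e' : (mirabolicMat hϖ n ((g * h).1 0 1))⁻¹ * g = d * h⁻¹ := by
    rw [inv_mul_eq_iff_eq_mul, ← mul_assoc, ← e, mul_inv_cancel_right]
  rw [e']
  exact mul_mem (Subgroup.mem_sup_left hd) (inv_mem hh)

end Mirabolic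

section Nondegenerate

universe u v w

variable {F : Type u} [Field F] [ValuativeRel F] [TopologicalSpace F]
  {k : Type v} [Field k] {π : SmoothRep.{u, v, w} F k}
  {ϖ : 𝒪[F]} {hϖ : Irreducible ϖ} {σ : Subrepresentation (res π.ρ (KZ F))}

/-- The span of the translates of `σ` to the vertices at distance `n` from the origin. -/
def sphere (ϖ : 𝒪[F]) (σ : Subrepresentation (res π.ρ (KZ F))) (n : ℕ) : Submodule k π.V :=
  Submodule.span k {y | ∃ g, level ϖ g = n ∧ ∃ x ∈ σ, π.ρ g x = y}

theorem sphere_ne_bot (hϖ : Irreducible ϖ) (hσ : σ.toRepresentation.IsIrreducible) (n : ℕ) :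
    sphere ϖ σ n ≠ ⊥ := by
  obtain ⟨x, hx, hx0⟩ := exists_ne_zero_of_isIrreducible hσ
  refine (Submodule.ne_bot_iff _).2 ⟨π.ρ (mirabolicMat hϖ n 0) x,
    Submodule.subset_span ⟨_, level_mirabolicMat hϖ n, x, hx, rfl⟩, fun h => hx0 ?_⟩
  exact π.apply_injective _ (h.trans (map_zero _).symm)

variable [IsNonarchimedeanLocalField F]

/-- If `I⁺(π) ∩ I⁻(π) = 0`, then `π` is the direct sum of the translates of `σ`. -/
theorem exists_linearMap_of_inf_eq_bot (hirr : π.ρ.IsIrreducible)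
    (hσ : σ.toRepresentation.IsIrreducible) (h0 : Iplus π σ ⊓ Iminus ϖ hϖ π σ = ⊥)
    {V' : Type*} [AddCommGroup V'] [Module k V'] (θ : GL (Fin 2) F → π.V →ₗ[k] V')
    (hθ : ∀ (g h : GL (Fin 2) F), h ∈ KZ F → ∀ x ∈ σ, θ (g * h) x = θ g (π.ρ h x)) :
    ∃ Θ : π.V →ₗ[k] V', ∀ g, ∀ x ∈ σ, Θ (π.ρ g x) = θ g x := by
  obtain ⟨x, hx, hx0⟩ := exists_ne_zero_of_isIrreducible hσ
  obtain ⟨Θ, hΘ⟩ := exists_linearMap_apply_eq π hϖ (le_Iplus π σ)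
    (θ := fun g => θ g ∘ₗ σ.toSubmodule.subtype) (fun g h hh w => hθ g h hh w w.2)
    (fun g w hw => by
      have : (w : π.V) ∈ Iplus π σ ⊓ Iminus ϖ hϖ π σ := ⟨le_Iplus π σ w.2, hw⟩
      rw [h0, Submodule.mem_bot] at this
      refine ⟨0, by simp [this], ?_⟩
      simp [this])
    (SmoothRep.span_translates_eq_top hirr (S := σ) hx hx0)
  exact ⟨Θ, fun g x hx => hΘ g ⟨x, hx⟩⟩

theorem maxCompact_sphere (hϖ : Irreducible ϖ) {n : ℕ} {c : GL (Fin 2) F} (hc : c ∈ maxCompact F)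
    {y : π.V} (hy : y ∈ sphere ϖ σ n) : π.ρ c y ∈ sphere ϖ σ n := by
  refine (Submodule.span_le (p := (sphere ϖ σ n).comap (π.ρ c))).2 ?_ hy
  rintro _ ⟨g, hg, x, hx, rfl⟩
  exact Submodule.subset_span
    ⟨c * g, by rw [level_mul_left hϖ g hc, hg], x, hx, π.mul_apply c g x⟩

theorem linearIndependent_of_mem_sphere (hirr : π.ρ.IsIrreducible)
    (hσ : σ.toRepresentation.IsIrreducible) (h0 : Iplus π σ ⊓ Iminus ϖ hϖ π σ = ⊥)
    {y : ℕ → π.V} (hy : ∀ n, y n ∈ sphere ϖ σ n) (hy0 : ∀ n, y n ≠ 0) :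
    LinearIndependent k y := by
  classical
  have hproj (n : ℕ) : ∃ Θ : π.V →ₗ[k] π.V, Θ (y n) = y n ∧ ∀ m ≠ n, Θ (y m) = 0 := by
    obtain ⟨Θ, hΘ⟩ := exists_linearMap_of_inf_eq_bot hirr hσ h0
      (fun g => if level ϖ g = n then π.ρ g else 0) (fun g h hh x _ => by
        rw [level_mul_right hϖ g hh]
        split_ifs
        · exact π.mul_apply g h x
        · rfl)
    refine ⟨Θ, ?_, fun m hm => ?_⟩
    · refine (Submodule.span_le (p := LinearMap.eqLocus Θ LinearMap.id)).2 ?_ (hy n)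
      rintro _ ⟨g, hg, x, hx, rfl⟩
      change Θ (π.ρ g x) = π.ρ g x
      rw [hΘ g x hx, if_pos hg]
    · refine (Submodule.span_le (p := LinearMap.ker Θ)).2 ?_ (hy m)
      rintro _ ⟨g, hg, x, hx, rfl⟩
      change Θ (π.ρ g x) = 0
      rw [hΘ g x hx, if_neg (by rwa [hg]), LinearMap.zero_apply]
  rw [linearIndependent_iff']
  intro s c hc i hi
  obtain ⟨Θ, h1, h2⟩ := hproj i
  have := congrArg Θ hc
  rw [map_sum, map_zero, Finset.sum_eq_single i, map_smul, h1] at this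
  · exact (smul_eq_zero.1 this).resolve_right (hy0 i)
  · intro j _ hj
    rw [map_smul, h2 j hj, smul_zero]
  · exact fun h => absurd hi h

/-- A nonzero functional on `σ` that is invariant under the upper unipotent matrices of `K`,
extended to `π`. -/
theorem exists_unipotent_invariant {p : ℕ} [Fact p.Prime] [CharP 𝓀[F] p] [CharP k p]
    (hϖ : Irreducible ϖ) (hσ : σ.toRepresentation.IsIrreducible) :
    ∃ ψ : π.V →ₗ[k] k, (∃ x ∈ σ, ψ x ≠ 0) ∧ ∀ (t : 𝒪[F]), ∀ x ∈ σ,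
      ψ (π.ρ (integralMap F (GeneralLinearGroup.upperRightHom t)) x) = ψ x := by
  obtain ⟨x, hx, hx0⟩ := exists_ne_zero_of_isIrreducible hσ
  let H : Subgroup (GL (Fin 2) 𝒪[F]) :=
    (GeneralLinearGroup.upperRightHom (R := 𝒪[F])).toMonoidHom.range
  let f : H →* KZ F := ((integralMap F).comp H.subtype).codRestrict (KZ F)
    fun h => Subgroup.mem_sup_left (integralMap_mem_maxCompact _)
  let ρ : Representation k H σ.toSubmodule := σ.toRepresentation.comp f
  obtain ⟨φ, hφ⟩ : ∃ φ : Module.Dual k σ.toSubmodule, φ ⟨x, hx⟩ ≠ 0 := by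
    by_contra! h
    exact hx0 (congrArg Subtype.val ((Module.forall_dual_apply_eq_zero_iff k _).1 h))
  have := finiteIndex_congruenceSubgroup hϖ 1
  obtain ⟨ψ, -, hψ0, hψ⟩ := exists_ne_zero_fixed (p := p) ρ.dual
    ((congruenceSubgroup ϖ 1).subgroupOf H) (fun h => by
      obtain ⟨t, ht⟩ := h.2
      obtain ⟨c, hc⟩ := uniformizer_dvd_prime (p := p) hϖ
      refine ⟨1, mem_congruenceSubgroup.2 ⟨!![0, c * t.toAdd; 0, 0], ?_⟩⟩
      have e : (H.subtype (h ^ p ^ 1)) =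
          GeneralLinearGroup.upperRightHom (p • t.toAdd : 𝒪[F]) := by
        rw [AddChar.map_nsmul_eq_pow, pow_one, map_pow]
        exact congrArg (· ^ p) ht.symm
      rw [e]
      change !![1, p • t.toAdd; 0, 1] = _
      rw [nsmul_eq_mul, hc, Matrix.one_fin_two]
      simp [mul_assoc])
    (v := φ) (fun h => hφ (by simp [h])) (fun n hn => by
      ext y
      refine congrArg φ (Subtype.ext ?_)
      exact π.fixed_of_isIrreducible (p := p) hϖ hσ (inv_mem hn) y.2)
  obtain ⟨Ψ, hΨ⟩ := LinearMap.exists_extend ψ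
  have hΨ' (y : σ.toSubmodule) : Ψ y = ψ y := LinearMap.congr_fun hΨ y
  refine ⟨Ψ, ?_, fun t x hx => ?_⟩
  · by_contra! h
    refine hψ0 (LinearMap.ext fun y => ?_)
    rw [← hΨ', h y y.2, LinearMap.zero_apply]
  · let u : H := ⟨GeneralLinearGroup.upperRightHom t, Multiplicative.ofAdd t, rfl⟩
    have h1 := LinearMap.congr_fun (hψ u⁻¹) ⟨x, hx⟩
    have h2 : ψ (ρ (u⁻¹)⁻¹ ⟨x, hx⟩) = ψ ⟨x, hx⟩ := h1
    rw [inv_inv, ← hΨ', ← hΨ'] at h2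
    exact h2

theorem exists_mirabolic_invariant {p : ℕ} [Fact p.Prime] [CharP 𝓀[F] p] [CharP k p]
    (hirr : π.ρ.IsIrreducible) (hσ : σ.toRepresentation.IsIrreducible)
    (h0 : Iplus π σ ⊓ Iminus ϖ hϖ π σ = ⊥) :
    ∃ ψ : π.V →ₗ[k] k, ψ ≠ 0 ∧ ∀ b ∈ mirabolic hϖ, ∀ x, ψ (π.ρ b x) = ψ x := by
  obtain ⟨ψ₀, ⟨x₀, hx₀, hne⟩, hinv⟩ := exists_unipotent_invariant (p := p) hϖ hσ
  have hinv' (b : GL (Fin 2) F) (hb : b ∈ mirabolic hϖ) (hb' : b ∈ KZ F) (x : π.V) (hx : x ∈ σ) :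
      ψ₀ (π.ρ b x) = ψ₀ x := by
    obtain ⟨t, rfl⟩ := exists_upperRightHom_eq hϖ hb hb'
    exact hinv t x hx
  choose b hb hb' using fun y : GL (Fin 2) F ⧸ KZ F => exists_mirabolic_mul_KZ hϖ y.out
  have hbmk (g : GL (Fin 2) F) : (b g)⁻¹ * g ∈ KZ F := by
    obtain ⟨h, e⟩ := QuotientGroup.mk_out_eq_mul (KZ F) g
    have := mul_mem (hb' g) (inv_mem h.2)
    rwa [e, ← mul_assoc, mul_inv_cancel_right] at this
  have hσmem {h : GL (Fin 2) F} (hh : h ∈ KZ F) {x : π.V} (hx : x ∈ σ) : π.ρ h x ∈ σ :=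
    σ.apply_mem_toSubmodule ⟨h, hh⟩ hx
  obtain ⟨ψ, hψ⟩ := exists_linearMap_of_inf_eq_bot hirr hσ h0
    (fun g => ψ₀ ∘ₗ π.ρ ((b g)⁻¹ * g)) (fun g h hh x _ => by
      change ψ₀ (π.ρ ((b (g * h : GL (Fin 2) F))⁻¹ * (g * h)) x) =
        ψ₀ (π.ρ ((b g)⁻¹ * g) (π.ρ h x))
      rw [QuotientGroup.mk_mul_of_mem _ hh, ← π.mul_apply, mul_assoc])
  refine ⟨ψ, ?_, fun c hc x => ?_⟩
  · rintro rfl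
    apply hne
    have h1 := hψ 1 x₀ hx₀
    rw [LinearMap.zero_apply] at h1
    have h2 := hbmk 1
    rw [mul_one] at h2
    rw [h1, LinearMap.comp_apply, mul_one, hinv' _ (inv_mem (hb _)) h2 x₀ hx₀]
  · have htop := SmoothRep.span_translates_eq_top hirr (S := σ) hx₀ (fun h => hne (by simp [h]))
    suffices H : (⊤ : Submodule k π.V) ≤ LinearMap.eqLocus (ψ ∘ₗ π.ρ c) ψ from
      H (x := x) Submodule.mem_top
    rw [← htop, Submodule.span_le]
    rintro _ ⟨g, x, hx, rfl⟩
    change ψ (π.ρ c (π.ρ g x)) = ψ (π.ρ g x)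
    rw [← π.mul_apply, hψ _ x hx, hψ _ x hx]
    change ψ₀ (π.ρ ((b (c * g : GL (Fin 2) F))⁻¹ * (c * g)) x) = ψ₀ (π.ρ ((b g)⁻¹ * g) x)
    have e : (b (c * g : GL (Fin 2) F))⁻¹ * (c * g) =
        ((b (c * g : GL (Fin 2) F))⁻¹ * c * b g) * ((b g)⁻¹ * g) := by group
    rw [e, π.mul_apply]
    refine hinv' _ (mul_mem (mul_mem (inv_mem (hb _)) hc) (hb _)) ?_ _ (hσmem (hbmk g) hx)
    have := mul_mem (hbmk (c * g)) (inv_mem (hbmk g))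
    rwa [e, mul_inv_cancel_right] at this

/-- The canonical diagram of an irreducible representation is not zero. -/
theorem D₁_ne_bot {p : ℕ} [Fact p.Prime] [CharP 𝓀[F] p] [CharP k p]
    (hirr : π.ρ.IsIrreducible) (hcent : HasCentralCharacter π.ρ)
    (hσ : σ.toRepresentation.IsIrreducible) : (D₁ ϖ hϖ π σ).toSubmodule ≠ ⊥ := by
  intro h0
  obtain ⟨χ, hχ⟩ := hcent
  obtain ⟨ψ, hψ0, hψ⟩ := exists_mirabolic_invariant (p := p) hirr hσ h0
  let T : Subrepresentation π.ρ :=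
    { toSubmodule := ⨅ g, LinearMap.ker (ψ ∘ₗ π.ρ g)
      apply_mem_toSubmodule := by
        intro h x hx
        rw [Submodule.mem_iInf] at hx ⊢
        intro g
        have := hx (g * h)
        rw [LinearMap.mem_ker, LinearMap.comp_apply] at this ⊢
        rwa [← π.mul_apply] }
  have hT : T = ⊥ := by
    refine (eq_bot_or_eq_top T).resolve_right fun hT => hψ0 ?_
    ext x
    have hx : x ∈ T := by rw [hT]; exact Submodule.mem_top
    have := (Submodule.mem_iInf _).1 hx 1
    simpa using this
  let fixed : Submodule k π.V :=
    ⨅ g : congruenceSubgroup ϖ 1, LinearMap.eqLocus (π.ρ (integralMap F g)) LinearMap.id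
  have hfixed {x : π.V} : x ∈ fixed ↔
      ∀ g ∈ congruenceSubgroup ϖ 1, π.ρ (integralMap F g) x = x := by
    simp [fixed, Submodule.mem_iInf]
  choose y hy hy0 hyfix using fun n => π.exists_fixed_of_ne_bot (p := p) hϖ (sphere_ne_bot hϖ hσ n)
    (fun g _ x hx => maxCompact_sphere hϖ (integralMap_mem_maxCompact g) hx)
  have := finiteIndex_congruenceSubgroup hϖ 1
  let Φ : π.V →ₗ[k] (GL (Fin 2) 𝒪[F] ⧸ congruenceSubgroup ϖ 1 → k) :=
    LinearMap.pi fun q => ψ ∘ₗ π.ρ (integralMap F q.out)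
  have hΦ : ∀ x ∈ fixed, Φ x = 0 → x = 0 := by
    intro x hx hΦx
    suffices H : x ∈ T by
      rw [hT] at H
      exact (Submodule.mem_bot k).1 H
    refine (Submodule.mem_iInf _).2 fun g => ?_
    change ψ (π.ρ g x) = 0
    obtain ⟨b, hb, hb'⟩ := exists_mirabolic_mul_KZ hϖ g
    obtain ⟨_, ⟨a, rfl⟩, z, hz, e⟩ := Subgroup.mem_sup_of_normal_right.1 hb'
    have e' : g = b * (integralMap F a * z) := by rw [e, mul_inv_cancel_left]
    obtain ⟨c, ec⟩ := QuotientGroup.mk_out_eq_mul (congruenceSubgroup ϖ 1) a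
    have h1 : ψ (π.ρ (integralMap F (a * c)) x) = 0 := by
      rw [← ec]
      exact congrFun hΦx (a : GL (Fin 2) 𝒪[F] ⧸ congruenceSubgroup ϖ 1)
    rw [map_mul, π.mul_apply, hfixed.1 hx c c.2] at h1
    rw [e', π.mul_apply, hψ b hb, π.mul_apply, hχ ⟨z, hz⟩ x, map_smul, map_smul, h1, smul_zero]
  have hli := (linearIndependent_of_mem_sphere hirr hσ h0 hy hy0).map (f := Φ) (by
    rw [Submodule.disjoint_def]
    intro x hx hx'
    refine hΦ x ?_ hx'
    refine Submodule.span_le.2 ?_ hx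
    rintro _ ⟨n, rfl⟩
    exact hfixed.2 (hyfix n))
  exact not_finite_iff_infinite.2 (inferInstanceAs (Infinite ℕ)) hli.finite_of_isNoetherian

end Nondegenerate

section Extension

universe u v w w'

variable {F : Type u} [Field F] [ValuativeRel F] [TopologicalSpace F] [IsNonarchimedeanLocalField F]
  {k : Type v} [Field k] {π : SmoothRep.{u, v, w} F k} {π' : SmoothRep.{u, v, w'} F k}
  {ϖ : 𝒪[F]} {hϖ : Irreducible ϖ} {σ : Subrepresentation (res π.ρ (KZ F))}

/-- The restriction to the canonical diagram of `𝒦(φ)`. -/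
noncomputable def restrictHom (ϖ : 𝒪[F]) (hϖ : Irreducible ϖ) (π : SmoothRep.{u, v, w} F k)
    (σ : Subrepresentation (res π.ρ (KZ F))) (π' : SmoothRep.{u, v, w'} F k) :
    π.ρ.IntertwiningMap π'.ρ →ₗ[k]
      Diagram.Hom (canonicalDiagram ϖ hϖ π σ) (Diagram.calK π') where
  toFun φ := Diagram.comp (Diagram.calK.map φ) (canonicalDiagram.incl ϖ hϖ π σ)
  map_add' _ _ := rfl
  map_smul' _ _ := rfl

theorem span_translates_D₀ (hirr : π.ρ.IsIrreducible)
    (h1 : (D₁ ϖ hϖ π σ).toSubmodule ≠ ⊥) :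
    Submodule.span k {x | ∃ g, ∃ w ∈ D₀ ϖ hϖ π σ, π.ρ g w = x} = ⊤ := by
  obtain ⟨x, hx, hx0⟩ := Submodule.exists_mem_ne_zero_of_ne_bot h1
  exact SmoothRep.span_translates_eq_top hirr (S := D₀ ϖ hϖ π σ) (D₁_le_D₀ ϖ hϖ π σ hx) hx0

theorem restrictHom_injective (hirr : π.ρ.IsIrreducible)
    (h1 : (D₁ ϖ hϖ π σ).toSubmodule ≠ ⊥) :
    Function.Injective (restrictHom ϖ hϖ π σ π') := by
  intro φ φ' h
  have h0 (w : (D₀ ϖ hϖ π σ).toSubmodule) : φ (w : π.V) = φ' w :=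
    congrArg (fun f : Diagram.Hom (canonicalDiagram ϖ hϖ π σ) (Diagram.calK π') => f.1.1 w) h
  apply Representation.IntertwiningMap.ext
  refine LinearMap.ext_on_range (v := Subtype.val (p := (· ∈ {x | ∃ g, ∃ w ∈ D₀ ϖ hϖ π σ,
    π.ρ g w = x}))) (by rw [Subtype.range_coe]; exact span_translates_D₀ hirr h1) ?_
  rintro ⟨_, g, w, hw, rfl⟩
  change φ (π.ρ g w) = φ' (π.ρ g w)
  rw [φ.isIntertwining, φ'.isIntertwining, h0 ⟨w, hw⟩]

theorem restrictHom_surjective (hirr : π.ρ.IsIrreducible)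
    (h1 : (D₁ ϖ hϖ π σ).toSubmodule ≠ ⊥) :
    Function.Surjective (restrictHom ϖ hϖ π σ π') := by
  intro f
  let φ₀ : (D₀ ϖ hϖ π σ).toSubmodule →ₗ[k] π'.V := f.1.1.toLinearMap
  let φ₁ : (D₁ ϖ hϖ π σ).toSubmodule →ₗ[k] π'.V := f.1.2.toLinearMap
  have hφ₀ (h : GL (Fin 2) F) (hh : h ∈ KZ F) (w : (D₀ ϖ hϖ π σ).toSubmodule) :
      φ₀ ((D₀ ϖ hϖ π σ).toRepresentation ⟨h, hh⟩ w) = π'.ρ h (φ₀ w) :=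
    f.1.1.isIntertwining _ _ ⟨h, hh⟩ w
  have hφ₁ (h : GL (Fin 2) F) (hh : h ∈ N F) (w : (D₁ ϖ hϖ π σ).toSubmodule) :
      φ₁ ((D₁ ϖ hϖ π σ).toRepresentation ⟨h, hh⟩ w) = π'.ρ h (φ₁ w) :=
    f.1.2.isIntertwining _ _ ⟨h, hh⟩ w
  have hr (w : (D₁ ϖ hϖ π σ).toSubmodule) :
      φ₀ (Submodule.inclusion (D₁_le_D₀ ϖ hϖ π σ) w) = φ₁ w := f.2 w
  obtain ⟨Φ, hΦ⟩ := exists_linearMap_apply_eq π hϖ (D₀_le_Iplus π ϖ hϖ σ)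
    (θ := fun g => π'.ρ g ∘ₗ φ₀)
    (fun g h hh w => by
      rw [LinearMap.comp_apply, LinearMap.comp_apply, hφ₀, π'.mul_apply])
    (fun g w hw => by
      let w₁ : (D₁ ϖ hϖ π σ).toSubmodule := ⟨w, D₀_le_Iplus π ϖ hϖ σ w.2, hw⟩
      let w₂ : (D₁ ϖ hϖ π σ).toSubmodule :=
        (D₁ ϖ hϖ π σ).toRepresentation ⟨_, inv_mem (PiMat_mem_N hϖ)⟩ w₁
      have e1 : φ₀ w = φ₁ w₁ := hr w₁
      have e2 : φ₁ w₂ = π'.ρ (PiMat ϖ hϖ)⁻¹ (φ₁ w₁) := hφ₁ _ _ w₁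
      refine ⟨Submodule.inclusion (D₁_le_D₀ ϖ hϖ π σ) w₂, π.self_apply_inv _ _, ?_⟩
      rw [LinearMap.comp_apply, LinearMap.comp_apply, hr w₂, e2, π'.mul_apply,
        π'.self_apply_inv, e1])
    (span_translates_D₀ hirr h1)
  have hΦ₀ (w : (D₀ ϖ hϖ π σ).toSubmodule) : Φ w = φ₀ w := by
    have := hΦ 1 w
    simpa using this
  let Φ' : π.ρ.IntertwiningMap π'.ρ := ⟨Φ, fun h => by
    refine LinearMap.ext_on_range (v := Subtype.val (p := (· ∈ {x | ∃ g, ∃ w ∈ D₀ ϖ hϖ π σ,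
      π.ρ g w = x}))) (by rw [Subtype.range_coe]; exact span_translates_D₀ hirr h1) ?_
    rintro ⟨_, g, w, hw, rfl⟩
    change Φ (π.ρ h (π.ρ g w)) = π'.ρ h (Φ (π.ρ g w))
    rw [← π.mul_apply, hΦ (h * g) ⟨w, hw⟩, hΦ g ⟨w, hw⟩, LinearMap.comp_apply,
      LinearMap.comp_apply, π'.mul_apply]⟩
  refine ⟨Φ', Subtype.ext (Prod.ext ?_ ?_)⟩
  · exact Representation.IntertwiningMap.ext (LinearMap.ext fun w => hΦ₀ w)
  · refine Representation.IntertwiningMap.ext (LinearMap.ext fun w => ?_)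
    exact (hΦ₀ (Submodule.inclusion (D₁_le_D₀ ϖ hϖ π σ) w)).trans (hr w)

end Extension

end CanonicalDiagram

theorem mainTheorem1
    {F : Type*} [Field F] [ValuativeRel F] [TopologicalSpace F] [IsNonarchimedeanLocalField F]
    {p : ℕ} [Fact p.Prime] [CharP 𝓀[F] p]
    {k : Type*} [Field k] [IsAlgClosed k] [CharP k p]
    (ϖ : 𝒪[F]) (hϖ : Irreducible ϖ)
    (π : CanonicalDiagram.SmoothRep F k) (hirr : π.ρ.IsIrreducible)
    (hcent : CanonicalDiagram.HasCentralCharacter π.ρ) :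
    (∃ σ : Subrepresentation (CanonicalDiagram.res π.ρ (CanonicalDiagram.KZ F)),
      σ.toRepresentation.IsIrreducible) ∧
    ∀ σ : Subrepresentation (CanonicalDiagram.res π.ρ (CanonicalDiagram.KZ F)),
      σ.toRepresentation.IsIrreducible →
      ∃ e : ∀ π' : CanonicalDiagram.SmoothRep F k,
          CanonicalDiagram.Diagram.Hom (CanonicalDiagram.canonicalDiagram ϖ hϖ π σ)
            (CanonicalDiagram.Diagram.calK π') ≃ₗ[k] π.ρ.IntertwiningMap π'.ρ,
        (∀ (π' : CanonicalDiagram.SmoothRep F k) (φ : π.ρ.IntertwiningMap π'.ρ),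
          (e π').symm φ = CanonicalDiagram.Diagram.comp (CanonicalDiagram.Diagram.calK.map φ)
            (CanonicalDiagram.canonicalDiagram.incl ϖ hϖ π σ)) ∧
        ∀ (π' π'' : CanonicalDiagram.SmoothRep F k) (ψ : π'.ρ.IntertwiningMap π''.ρ)
          (f : CanonicalDiagram.Diagram.Hom (CanonicalDiagram.canonicalDiagram ϖ hϖ π σ)
            (CanonicalDiagram.Diagram.calK π')),
          e π'' (CanonicalDiagram.Diagram.comp (CanonicalDiagram.Diagram.calK.map ψ) f) =
            ψ.comp (e π' f) := by
  refine ⟨?_, fun σ hσ => ?_⟩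
  · have : Nontrivial π.V := by
      by_contra h
      rw [not_nontrivial_iff_subsingleton] at h
      exact bot_ne_top (α := Subrepresentation π.ρ)
        (Subrepresentation.toSubmodule_injective (Subsingleton.elim _ _))
    exact π.exists_isIrreducible hcent hϖ
  have h1 := CanonicalDiagram.D₁_ne_bot (p := p) (ϖ := ϖ) (hϖ := hϖ) hirr hcent hσ
  let e := fun π' : CanonicalDiagram.SmoothRep F k =>
    (LinearEquiv.ofBijective (CanonicalDiagram.restrictHom ϖ hϖ π σ π')
      ⟨CanonicalDiagram.restrictHom_injective hirr h1,
        CanonicalDiagram.restrictHom_surjective hirr h1⟩).symm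
  refine ⟨e, fun π' φ => rfl, fun π' π'' ψ f => ?_⟩
  rw [LinearEquiv.symm_apply_eq]
  obtain ⟨φ, rfl⟩ := (e π').symm.surjective f
  rw [LinearEquiv.apply_symm_apply]
  rfl
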